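/- Let $k$ be a field of characteristic $0$ and $n\ge 1$. For $\vec m,\vec l\in\mathbb Z_{\ge0}^n$ write $\vec m\prec\vec l$ if $m_i\le l_i$ for all $i$ and $m_i<l_i$ for some $i$. An associative $n$-conformal algebra over $k$ is a $k$-vector space $C$ with bilinear products $a\langle\vec m\rangle b$ ($\vec m\in\mathbb Z_{\ge0}^n$) and pairwise commuting linear maps $D_1,\dots,D_n:C\to C$ such that for all $a,b,c\in C$, $\vec m,\vec m'\in\mathbb Z_{\ge0}^n$ and $1\le i\le n$: (i) there is $\vec N(a,b)\in\mathbb Z_{\ge0}^n$ with $a\langle\vec l\rangle b=0$ for all $\vec l\not\prec\vec N(a,b)$; (ii) $D_i(a\langle\vec m\rangle b)=D_ia\langle\vec m\rangle b+a\langle\vec m\rangle D_ib$; (iii) $D_ia\langle\vec m\rangle b=-m_i\,a\langle\vec m-\vec e_i\rangle b$ (read as $0$ if $m_i=0$); (iv) $(a\langle\vec m\rangle b)\langle\vec m'\rangle c=\sum_{\vec s\le\vec m}(-1)^{s_1+\cdots+s_n}\binom{m_1}{s_1}\cdots\binom{m_n}{s_n}\,a\langle\vec m-\vec s\rangle(b\langle\vec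 m'+\vec s\rangle c)$. Homomorphisms are linear maps preserving all products and commuting with all $D_i$. Let $B$ be a non-empty set and $\vec N:B\times B\to\mathbb Z_{\ge0}^n$ any function. A free associative $n$-conformal algebra $C(B,\vec N,D_1,\dots,D_n)$ is an associative $n$-conformal algebra $C$ with a map $\iota:B\to C$ such that $C$ is generated by $\iota(B)$ (under linear combinations, the products and the $D_i$), $\iota(a)\langle\vec m\rangle\iota(b)=0$ for all $a,b\in B$ and $\vec m\not\prec\vec N(a,b)$, and for every associative $n$-conformal algebra $C'$ and every map $\varepsilon:B\to C'$ with $\varepsilon(a)\langle\vec m\rangle\varepsilon(b)=0$ for all $a,b\in B$ and $\vec m\not\prec\vec N(a,b)$ there is a unique homomorphism $f:C\to C'$ with $f\circ\iota=\varepsilon$. A normal word is a formal expression $$a_1\langle\vec m^{(1)}\rangle(a_2\langle\vec m^{(2)}\rangle\cdots(a_t\langle\vec m^{(t)}\rangle D_1^{i_1}\cdots D_n^{i_n}a_{t+1})\cdots),$$ where $t\ge0$, $a_1,\dots,a_{t+1}\in B$, $i_1,\dots,i_n\in\mathbb Z_{\ge0}$ and $\vec m^{(j)}\prec\vec N(a_j,a_{j+1})$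 for $1\le j\le t$. It has a value in any free associative $n$-conformal algebra, obtained by reading each $a_j$ as $\iota(a_j)$. Then a free associative $n$-conformal algebra $C(B,\vec N,D_1,\dots,D_n)$ exists, and in every such algebra the normal words form a $k$-linear basis (distinct normal words having distinct values). -/

import Mathlib

universe u v w t

/-- An `n`-conformal algebra over `k`: a `k`-vector space with bilinear products `a ⟨m⟩ b`
indexed by `m ∈ ℕⁿ` and commuting linear maps `D₁, …, Dₙ`.  The strict order `<` on
`Fin n → ℕ` is the pointwise one: `m < l` iff `m i ≤ l i` for all `i` and `m i < l i`
for some `i`. -/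
class NConformalAlgebra (k : Type u) (n : ℕ) (C : Type w) [Field k] [AddCommGroup C]
    [Module k C] where
  /-- The product `a ⟨m⟩ b`. -/
  mul : (Fin n → ℕ) → C →ₗ[k] C →ₗ[k] C
  /-- The derivations `D₁, …, Dₙ`. -/
  D : Fin n → Module.End k C
  D_comm : ∀ i j, D i * D j = D j * D i
  locality : ∀ a b : C, ∃ N : Fin n → ℕ, ∀ m : Fin n → ℕ, ¬ m < N → mul m a b = 0
  D_mul : ∀ (i : Fin n) (m : Fin n → ℕ) (a b : C),
    D i (mul m a b) = mul m (D i a) b + mul m a (D i b)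
  -- if `m i = 0`, the coefficient on the right-hand side vanishes
  D_left : ∀ (i : Fin n) (m : Fin n → ℕ) (a b : C),
    mul m (D i a) b = (-(m i : k)) • mul (m - Pi.single i 1) a b

/-- An associative `n`-conformal algebra.  The sum ranges over `s ≤ m`; for all other `s`
the binomial coefficient vanishes. -/
class AssocNConformalAlgebra (k : Type u) (n : ℕ) (C : Type w) [Field k] [AddCommGroup C]
    [Module k C] extends NConformalAlgebra k n C where
  assoc : ∀ (a b c : C) (m m' : Fin n → ℕ),
    mul m' (mul m a b) c =
      ∑ s ∈ Finset.Iic m,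
        ((-1 : k) ^ (∑ i, s i) * ∏ i, ((m i).choose (s i) : k)) •
          mul (m - s) a (mul (m' + s) b c)

/-- Homomorphisms of `n`-conformal algebras: linear maps preserving all products and
commuting with all derivations. -/
structure NConformalHom (k : Type u) (n : ℕ) (C : Type w) (C' : Type t) [Field k]
    [AddCommGroup C] [Module k C] [NConformalAlgebra k n C]
    [AddCommGroup C'] [Module k C'] [NConformalAlgebra k n C'] extends C →ₗ[k] C' where
  map_mul : ∀ (m : Fin n → ℕ) (a b : C),
    toFun (NConformalAlgebra.mul (k := k) m a b) =
      NConformalAlgebra.mul (k := k) m (toFun a) (toFun b)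
  map_D : ∀ (i : Fin n) (a : C),
    toFun (NConformalAlgebra.D (k := k) i a) = NConformalAlgebra.D (k := k) i (toFun a)

/-- The map `ε : B → C` respects the locality function `N`:
`ε a ⟨m⟩ ε b = 0` whenever `m ⊀ N a b`. -/
def RespectsLocality (k : Type u) (n : ℕ) {B : Type v} (N : B → B → Fin n → ℕ)
    {C : Type w} [Field k] [AddCommGroup C] [Module k C] [NConformalAlgebra k n C]
    (ε : B → C) : Prop :=
  ∀ (a b : B) (m : Fin n → ℕ), ¬ m < N a b →
    NConformalAlgebra.mul (k := k) m (ε a) (ε b) = 0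

/-- `C` is generated, as an `n`-conformal algebra, by the image of `ι : B → C`. -/
def IsGeneratedBy (k : Type u) (n : ℕ) {B : Type v} {C : Type w} [Field k] [AddCommGroup C]
    [Module k C] [NConformalAlgebra k n C] (ι : B → C) : Prop :=
  ∀ S : Submodule k C, (∀ b, ι b ∈ S) →
    (∀ (i : Fin n), ∀ a ∈ S, NConformalAlgebra.D (k := k) i a ∈ S) →
    (∀ (m : Fin n → ℕ), ∀ a ∈ S, ∀ b ∈ S, NConformalAlgebra.mul (k := k) m a b ∈ S) →
    S = ⊤

/-- `(C, ι)` is a free associative `n`-conformal algebra with the data `(B, N, D₁, …, Dₙ)`;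
the algebras tested in the universal property live in `Type t`. -/
structure IsFreeAssocNConformal (k : Type u) (n : ℕ) {B : Type v} (N : B → B → Fin n → ℕ)
    (C : Type w) [Field k] [AddCommGroup C] [Module k C] [AssocNConformalAlgebra k n C]
    (ι : B → C) : Prop where
  generated : IsGeneratedBy k n ι
  respects : RespectsLocality k n N ι
  universal : ∀ (C' : Type t) [AddCommGroup C'] [Module k C'] [AssocNConformalAlgebra k n C']
    (ε : B → C'), RespectsLocality k n N ε →
      ∃! f : NConformalHom k n C C', ∀ b, f.toLinearMap (ι b) = ε b

/-- Nonassociative words on `D^ω(B) = {D₁^{i₁} ⋯ Dₙ^{iₙ} b}`: `letter i b` is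
`D₁^{i₁} ⋯ Dₙ^{iₙ} b`, and `mul u m v` is `(u ⟨m⟩ v)`. -/
inductive ConformalWord (n : ℕ) (B : Type v) : Type v
  | letter (i : Fin n → ℕ) (b : B) : ConformalWord n B
  | mul (p : ConformalWord n B) (m : Fin n → ℕ) (q : ConformalWord n B) : ConformalWord n B

namespace ConformalWord

/-- The element of `B` underlying the first letter of a word. -/
def head {n : ℕ} {B : Type v} : ConformalWord n B → B
  | letter _ b => b
  | mul p _ _ => head p

/-- Normal words: right normed words
`a₁ ⟨m¹⟩ (a₂ ⟨m²⟩ ⋯ (a_t ⟨mᵗ⟩ D₁^{i₁} ⋯ Dₙ^{iₙ} a_{t+1}) ⋯)` with all `a_j ∈ B` and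
`mʲ ≺ N(a_j, a_{j+1})`. -/
inductive IsNormal {n : ℕ} {B : Type v} (N : B → B → Fin n → ℕ) : ConformalWord n B → Prop
  | letter (i : Fin n → ℕ) (b : B) : IsNormal N (letter i b)
  | mul (a : B) (m : Fin n → ℕ) (p : ConformalWord n B) (hm : m < N a p.head)
      (hp : IsNormal N p) : IsNormal N (mul (letter 0 a) m p)

/-- The value of a word in an `n`-conformal algebra, the letters `b ∈ B` being read as `ι b`. -/
def eval (k : Type u) {n : ℕ} {B : Type v} {C : Type w} [Field k] [AddCommGroup C]
    [Module k C] [NConformalAlgebra k n C] (ι : B → C) : ConformalWord n B → C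
  | letter i b => (List.ofFn fun j => NConformalAlgebra.D (k := k) (C := C) j ^ i j).prod (ι b)
  | mul p m q => NConformalAlgebra.mul (k := k) m (eval k ι p) (eval k ι q)

end ConformalWord

/-! Spanning is a rewriting argument. When `m` is not below `N a b`, associativity applied to `(a
⟨m⟩ b) ⟨m'⟩ x = 0` expresses `a ⟨m⟩ (b ⟨m'⟩ x)` through terms with smaller first index
(`mul_mul_mem_normalSpan`). Hence the span of the normal words is closed under all operations
(`mul_mem_normalSpanTop`).

For independence an algebra is built on the vector space of normal words. As a heuristic, read `a
⟨m⟩ b` as `Res_w a(w) (w - z)^m b(z)`. A left normed product then carries powers of the differences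
of consecutive variables, and locality annihilates such a power exactly when it is too high. So a
basis word records the powers of consecutive differences, followed by an outer `D^i`. In this
picture `cons a q` inserts `a(w) (w - w₁)^q` in front, where `w₁` is the previous first variable,
and `raise j` multiplies by the `j`-th coordinate of `w₁ - z`, the sum of all consecutive
differences. A generator therefore has to act by `b ⟨l⟩ x = raise^l (cons b 0 x)`, and `leftMul`
extends this to all left factors. The axioms follow from the relations between `raise`, `der` and
`cons`, chiefly `leftMul_raise` and `leftMul_leftMul`; locality holds because `raise` lowers a
weight.

In the model, right normed normal words equal the basis words up to terms of smaller depth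
(`eval_sub_word_mem_depthSpan`), so their values form a basis. The universal property is then a
graph argument: by the spanning result in a product algebra, the graph of the linear extension is a
subalgebra. Independence in an arbitrary free algebra is pulled back from the model. -/

section MultiIndex

/-! ### Multi-indices, monomials in commuting operators, signed binomial coefficients. -/

theorem multiIndex_induction {n : ℕ} {P : (Fin n → ℕ) → Prop} (zero : P 0)
    (add_single : ∀ l j, P l → P (l + Pi.single j 1)) (l : Fin n → ℕ) : P l := by
  induction h : ∑ i, l i generalizing l with
  | zero =>
    have : l = 0 := by
      funext i
      exact (Finset.sum_eq_zero_iff.1 h) i (Finset.mem_univ i)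
    exact this ▸ zero
  | succ r ih =>
    obtain ⟨j, hj⟩ : ∃ j, l j ≠ 0 := by
      by_contra hcon
      push Not at hcon
      simp [hcon] at h
    have hl : l = (l - Pi.single j 1) + Pi.single j 1 := by
      funext i
      by_cases hi : i = j
      · subst hi
        simp
        omega
      · simp [hi]
    have hsum := congrArg (fun f : Fin n → ℕ => ∑ i, f i) hl
    simp only [Pi.add_apply, Finset.sum_add_distrib, Finset.sum_pi_single', Finset.mem_univ,
      if_true] at hsum
    rw [hl]
    exact add_single _ _ (ih _ (by simp only [Pi.sub_apply] at hsum ⊢; omega))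

/-- The product `X₁ ^ l₁ ⋯ Xₙ ^ lₙ`. -/
def monomialProd {n : ℕ} {M : Type*} [Monoid M] (X : Fin n → M) (l : Fin n → ℕ) : M :=
  (List.ofFn fun j => X j ^ l j).prod

@[simp]
theorem monomialProd_zero {n : ℕ} {M : Type*} [Monoid M] (X : Fin n → M) :
    monomialProd X 0 = 1 := by
  simp [monomialProd]

theorem monomialProd_add_single {n : ℕ} {M : Type*} [Monoid M] {X : Fin n → M}
    (hX : ∀ i j, X i * X j = X j * X i) (l : Fin n → ℕ) (j : Fin n) :
    monomialProd X (l + Pi.single j 1) = X j * monomialProd X l := by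
  induction n with
  | zero => exact j.elim0
  | succ n ih =>
    have hsplit : ∀ r : Fin (n + 1) → ℕ, monomialProd X r =
        X 0 ^ r 0 * monomialProd (fun i => X (Fin.succ i)) (fun i => r (Fin.succ i)) := by
      intro r
      simp [monomialProd, List.ofFn_succ]
    rw [hsplit, hsplit l]
    refine Fin.cases ?_ (fun j => ?_) j
    · have : (fun i : Fin n => (l + Pi.single 0 1 : Fin (n + 1) → ℕ) (Fin.succ i)) = fun i => l (Fin.succ i) := by
        funext i
        simp
      rw [this]
      simp [pow_succ', mul_assoc]
    · have : (fun i : Fin n => (l + Pi.single (Fin.succ j) 1 : Fin (n + 1) → ℕ) (Fin.succ i)) =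
          (fun i => l (Fin.succ i)) + Pi.single j 1 := by
        funext i
        by_cases hi : i = j
        · subst hi; simp
        · simp [hi]
      rw [this, ih (X := fun i => X (Fin.succ i)) (fun i j => hX _ _)]
      have h0 : (l + Pi.single (Fin.succ j) 1 : Fin (n + 1) → ℕ) 0 = l 0 := by simp [Fin.succ_ne_zero]
      have hc : Commute (X 0 ^ l 0) (X (Fin.succ j)) :=
        Commute.pow_left (hX _ _ : Commute (X 0) (X (Fin.succ j))) _
      rw [h0, ← mul_assoc, hc.eq, mul_assoc]

theorem add_single_tsub_single_of_ne {n : ℕ} {i j : Fin n} (h : i ≠ j) (l : Fin n → ℕ) :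
    l + Pi.single i 1 - Pi.single j 1 = l - Pi.single j 1 + Pi.single i 1 := by
  funext x
  by_cases hx : x = j
  · subst hx; simp [h.symm]
  · simp [hx]

theorem tsub_single_add_single {n : ℕ} {j : Fin n} {l : Fin n → ℕ} (h : l j ≠ 0) :
    l - Pi.single j 1 + Pi.single j 1 = l := by
  funext x
  by_cases hx : x = j
  · subst hx; simp; omega
  · simp [hx]

/-- The relation `[Y_j, X^l] = l_j X^{l - e_j}` in an algebra with `[Y_i, X_j] = δ_{ij}`. -/
theorem mul_monomialProd {n : ℕ} {R : Type*} [Ring R] {X Y : Fin n → R}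
    (hX : ∀ i j, X i * X j = X j * X i)
    (hYX : ∀ i j, Y i * X j = X j * Y i + if i = j then 1 else 0) (j : Fin n)
    (l : Fin n → ℕ) :
    Y j * monomialProd X l =
      monomialProd X l * Y j + (l j : R) * monomialProd X (l - Pi.single j 1) := by
  induction l using multiIndex_induction with
  | zero => simp
  | add_single l i ih =>
    rw [monomialProd_add_single hX, ← mul_assoc, hYX, add_mul, mul_assoc (X i), ih]
    by_cases h : j = i
    · subst h
      have key : (l j : R) * (X j * monomialProd X (l - Pi.single j 1)) =
          (l j : R) * monomialProd X l := by
        by_cases hl : l j = 0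
        · simp [hl]
        · rw [← monomialProd_add_single hX, tsub_single_add_single hl]
      have hc : X j * ((l j : R) * monomialProd X (l - Pi.single j 1)) =
          (l j : R) * (X j * monomialProd X (l - Pi.single j 1)) := by
        rw [← mul_assoc, ← mul_assoc, (Nat.cast_commute (l j) (X j)).eq]
      rw [mul_add, hc, key]
      simp only [if_true, add_tsub_cancel_right, Pi.add_apply, Pi.single_eq_same, Nat.cast_add,
        Nat.cast_one, add_mul, one_mul, mul_assoc]
      abel
    · rw [add_single_tsub_single_of_ne (Ne.symm h), monomialProd_add_single hX]
      have hc : X i * ((l j : R) * monomialProd X (l - Pi.single j 1)) =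
          (l j : R) * (X i * monomialProd X (l - Pi.single j 1)) := by
        rw [← mul_assoc, ← mul_assoc, (Nat.cast_commute (l j) (X i)).eq]
      simp [h, mul_add, hc, mul_assoc]

/-- The coefficient `(-1)^{s₁ + ⋯ + sₙ} ∏ (mᵢ choose sᵢ)`. -/
def signedChoose (k : Type u) [Field k] {n : ℕ} (m s : Fin n → ℕ) : k :=
  (-1 : k) ^ (∑ i, s i) * ∏ i, ((m i).choose (s i) : k)

theorem signedChoose_eq_mul (k : Type u) [Field k] {n : ℕ} (m s : Fin n → ℕ) (j : Fin n) :
    signedChoose k m s = ((-1 : k) ^ s j * ((m j).choose (s j) : k)) *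
      ∏ i ∈ Finset.univ.erase j, ((-1 : k) ^ s i * ((m i).choose (s i) : k)) := by
  rw [signedChoose, ← Finset.prod_pow_eq_pow_sum, ← Finset.prod_mul_distrib,
    Finset.mul_prod_erase _ (fun i => (-1 : k) ^ s i * ((m i).choose (s i) : k))
      (Finset.mem_univ j)]

theorem signedChoose_eq_zero {k : Type u} [Field k] {n : ℕ} {m s : Fin n → ℕ} (h : ¬ s ≤ m) :
    signedChoose k m s = 0 := by
  obtain ⟨j, hj⟩ : ∃ j, m j < s j := by
    by_contra hcon
    push Not at hcon
    exact h hcon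
  rw [signedChoose_eq_mul k m s j, Nat.choose_eq_zero_of_lt hj]
  simp

@[simp]
theorem signedChoose_zero_right {k : Type u} [Field k] {n : ℕ} (m : Fin n → ℕ) :
    signedChoose k m 0 = 1 := by
  simp [signedChoose]

theorem signedChoose_congr_erase {k : Type u} [Field k] {n : ℕ} {m m' s s' : Fin n → ℕ}
    (j : Fin n) (hm : ∀ i, i ≠ j → m i = m' i) (hs : ∀ i, i ≠ j → s i = s' i) :
    (∏ i ∈ Finset.univ.erase j, ((-1 : k) ^ s i * ((m i).choose (s i) : k))) =
      ∏ i ∈ Finset.univ.erase j, ((-1 : k) ^ s' i * ((m' i).choose (s' i) : k)) :=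
  Finset.prod_congr rfl fun i hi => by
    rw [hm i (Finset.ne_of_mem_erase hi), hs i (Finset.ne_of_mem_erase hi)]

theorem signedChoose_add_single_of_eq_zero {k : Type u} [Field k] {n : ℕ} {m s : Fin n → ℕ}
    {j : Fin n} (h : s j = 0) :
    signedChoose k (m + Pi.single j 1) s = signedChoose k m s := by
  rw [signedChoose_eq_mul k _ s j, signedChoose_eq_mul k m s j,
    signedChoose_congr_erase (m' := m) (s' := s) j (fun i hi => by simp [hi]) (fun _ _ => rfl)]
  simp [h]

theorem signedChoose_add_single_add_single {k : Type u} [Field k] {n : ℕ} (m s : Fin n → ℕ)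
    (j : Fin n) :
    signedChoose k (m + Pi.single j 1) (s + Pi.single j 1) =
      signedChoose k m (s + Pi.single j 1) - signedChoose k m s := by
  rw [signedChoose_eq_mul k _ _ j, signedChoose_eq_mul k m _ j, signedChoose_eq_mul k m s j,
    signedChoose_congr_erase (m' := m) (s' := s) j (fun i hi => by simp [hi])
      (fun i hi => by simp [hi]),
    signedChoose_congr_erase (m := m) (m' := m) (s := s + Pi.single j 1) (s' := s) j
      (fun i hi => rfl) (fun i hi => by simp [hi])]
  simp only [Pi.add_apply, Pi.single_eq_same, Nat.choose_succ_succ', Nat.cast_add, pow_succ]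
  ring

/-- The absorption identity for binomials, in the form that makes associativity compatible with the
rule for `D_j` in a left factor. It survives truncated subtraction because both binomials vanish
when `s j > m j`. -/
theorem signedChoose_mul_tsub {k : Type u} [Field k] {n : ℕ} (m s : Fin n → ℕ) (j : Fin n) :
    signedChoose k m s * ((m - s) j : ℕ) = (m j : k) * signedChoose k (m - Pi.single j 1) s := by
  rw [signedChoose_eq_mul k m s j, signedChoose_eq_mul k _ s j,
    signedChoose_congr_erase (m := m - Pi.single j 1) (m' := m) (s := s) (s' := s) j
      (fun i hi => by simp [hi]) (fun i hi => rfl)]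
  have key : ((m j).choose (s j) : k) * ((m j - s j : ℕ) : k) =
      (m j : k) * ((m j - 1).choose (s j) : k) := by
    rcases Nat.eq_zero_or_pos (m j) with h | h
    · simp [h]
    · obtain ⟨r, hr⟩ : ∃ r, m j = r + 1 := ⟨m j - 1, by omega⟩
      rw [hr, Nat.add_sub_cancel]
      have h : (r + 1).choose (s j) * (r + 1 - s j) = (r + 1) * r.choose (s j) := by
        rw [← Nat.choose_mul_succ_eq, mul_comm]
      rw [← Nat.cast_mul, h, Nat.cast_mul]
  simp only [Pi.sub_apply, Pi.single_eq_same]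
  linear_combination (-1 : k) ^ s j *
    (∏ i ∈ Finset.univ.erase j, ((-1 : k) ^ s i * ((m i).choose (s i) : k))) * key

/-- Pascal's rule for sums with the coefficients `signedChoose`. -/
theorem sum_signedChoose_add_single {k : Type u} [Field k] {V : Type*} [AddCommGroup V]
    [Module k V] {n : ℕ} (m : Fin n → ℕ) (j : Fin n) (X : (Fin n → ℕ) → V) :
    ∑ s ∈ Finset.Iic (m + Pi.single j 1), signedChoose k (m + Pi.single j 1) s • X s =
      ∑ s ∈ Finset.Iic m, signedChoose k m s • (X s - X (s + Pi.single j 1)) := by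
  have hsub : Finset.Iic m ⊆ Finset.Iic (m + Pi.single j 1) :=
    Finset.Iic_subset_Iic.2 le_self_add
  have h1 : ∑ s ∈ Finset.Iic m, signedChoose k m s • X s =
      ∑ s ∈ Finset.Iic (m + Pi.single j 1), signedChoose k m s • X s :=
    Finset.sum_subset hsub fun s _ hs => by
      rw [signedChoose_eq_zero (by simpa using hs), zero_smul]
  have h2 : ∑ s ∈ Finset.Iic (m + Pi.single j 1),
      (signedChoose k m s - signedChoose k (m + Pi.single j 1) s) • X s =
      ∑ s ∈ Finset.Iic m, signedChoose k m s • X (s + Pi.single j 1) := by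
    have himg : (Finset.Iic m).image (fun s => s + Pi.single j 1) ⊆
        Finset.Iic (m + Pi.single j 1) := by
      intro s hs
      obtain ⟨t, ht, rfl⟩ := Finset.mem_image.1 hs
      exact Finset.mem_Iic.2 (add_le_add_left (Finset.mem_Iic.1 ht) _)
    rw [← Finset.sum_subset himg, Finset.sum_image fun a _ b _ h => add_right_cancel h]
    · exact Finset.sum_congr rfl fun s _ => by
        rw [signedChoose_add_single_add_single, sub_sub_cancel]
    -- Outside the image of the shift `s j = 0`, where raising `m j` does not change the
    -- coefficient.
    · intro s hs hs'
      have hsj : s j = 0 := by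
        by_contra hne
        refine hs' (Finset.mem_image.2 ⟨s - Pi.single j 1, ?_, tsub_single_add_single hne⟩)
        exact Finset.mem_Iic.2 (tsub_le_iff_right.2 (Finset.mem_Iic.1 hs))
      rw [signedChoose_add_single_of_eq_zero hsj, sub_self, zero_smul]
  simp only [smul_sub, Finset.sum_sub_distrib]
  rw [h1, ← h2, ← Finset.sum_sub_distrib]
  exact Finset.sum_congr rfl fun s _ => by rw [← sub_smul, sub_sub_cancel]

end MultiIndex

/-! ### Normal words span every algebra generated by local generators. -/

section Spanning

open NConformalAlgebra

variable {k : Type u} [Field k] {n : ℕ} {C : Type w} [AddCommGroup C] [Module k C]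

theorem NConformalAlgebra.mul_D_right [NConformalAlgebra k n C] (j : Fin n) (m : Fin n → ℕ)
    (a b : C) :
    mul (k := k) m a (D (k := k) j b) =
      D (k := k) j (mul (k := k) m a b) +
        (m j : k) • mul (k := k) (m - Pi.single j 1) a b := by
  rw [D_mul, D_left]
  module

theorem AssocNConformalAlgebra.assoc_signedChoose [AssocNConformalAlgebra k n C] (a b c : C)
    (m m' : Fin n → ℕ) :
    mul (k := k) m' (mul (k := k) m a b) c =
      ∑ s ∈ Finset.Iic m, signedChoose k m s •
        mul (k := k) (m - s) a (mul (k := k) (m' + s) b c) :=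
  AssocNConformalAlgebra.assoc a b c m m'

namespace ConformalWord

variable {B : Type v}

theorem eval_letter_zero [NConformalAlgebra k n C] (ε : B → C) (b : B) :
    eval k ε (letter 0 b : ConformalWord n B) = ε b := by
  change monomialProd (D (k := k) (C := C)) 0 (ε b) = ε b
  simp

theorem eval_letter_add_single [NConformalAlgebra k n C] (ε : B → C) (b : B) (i : Fin n → ℕ)
    (j : Fin n) :
    eval k ε (letter (i + Pi.single j 1) b) = D (k := k) j (eval k ε (letter i b)) := by
  change monomialProd (D (k := k) (C := C)) _ (ε b) =
    D (k := k) j (monomialProd (D (k := k) (C := C)) i (ε b))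
  rw [monomialProd_add_single D_comm]
  rfl

theorem eval_mul_letter_zero [NConformalAlgebra k n C] (ε : B → C) (a : B) (m : Fin n → ℕ)
    (p : ConformalWord n B) :
    eval k ε (mul (letter 0 a) m p) = NConformalAlgebra.mul (k := k) m (ε a) (eval k ε p) := by
  rw [eval, eval_letter_zero]

variable (k) in
/-- The span of the values of the normal words with first letter `h`. -/
def normalSpan [NConformalAlgebra k n C] (N : B → B → Fin n → ℕ) (ε : B → C) (h : B) :
    Submodule k C :=
  Submodule.span k {x | ∃ p, IsNormal N p ∧ p.head = h ∧ eval k ε p = x}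

section

variable [NConformalAlgebra k n C] {N : B → B → Fin n → ℕ} {ε : B → C}

theorem IsNormal.eval_mem {p : ConformalWord n B} (hp : IsNormal N p) :
    eval k ε p ∈ normalSpan k N ε p.head :=
  Submodule.subset_span ⟨p, hp, rfl, rfl⟩

theorem mul_mem_normalSpan {a h : B} {m : Fin n → ℕ} (hm : m < N a h) {x : C}
    (hx : x ∈ normalSpan k N ε h) :
    NConformalAlgebra.mul (k := k) m (ε a) x ∈ normalSpan k N ε a := by
  refine Submodule.span_induction (p := fun x _ =>
    NConformalAlgebra.mul (k := k) m (ε a) x ∈ normalSpan k N ε a) ?_ ?_ ?_ ?_ hx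
  · rintro _ ⟨p, hp, rfl, rfl⟩
    rw [← eval_mul_letter_zero]
    exact (IsNormal.mul a m p hm hp).eval_mem
  · simp
  · intro x y _ _ hx hy
    rw [map_add]
    exact add_mem hx hy
  · intro c x _ hx
    rw [map_smul]
    exact Submodule.smul_mem _ _ hx

/-- By the Leibniz rule, `D_j` either moves inward to the last letter or lowers an index, and
lowering an index preserves normality. -/
theorem D_mem_normalSpan (j : Fin n) {h : B} {x : C} (hx : x ∈ normalSpan k N ε h) :
    D (k := k) j x ∈ normalSpan k N ε h := by
  refine Submodule.span_induction (p := fun x _ => D (k := k) j x ∈ normalSpan k N ε h)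
    ?_ ?_ ?_ ?_ hx
  · rintro _ ⟨p, hp, rfl, rfl⟩
    clear hx
    induction hp with
    | letter i b =>
      rw [← eval_letter_add_single]
      exact IsNormal.eval_mem (IsNormal.letter (i + Pi.single j 1) b)
    | mul a m p hm hp ih =>
      rw [eval_mul_letter_zero, D_mul, D_left]
      exact add_mem (Submodule.smul_mem _ _
        (mul_mem_normalSpan (lt_of_le_of_lt tsub_le_self hm) hp.eval_mem))
        (mul_mem_normalSpan hm ih)
  · simp
  · intro x y _ _ hx hy
    rw [map_add]
    exact add_mem hx hy
  · intro c x _ hx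
    rw [map_smul]
    exact Submodule.smul_mem _ _ hx

theorem mul_letter_mem_normalSpan (hε : RespectsLocality k n N ε) (a b : B) (i : Fin n → ℕ) :
    ∀ m : Fin n → ℕ, NConformalAlgebra.mul (k := k) m (ε a) (eval k ε (letter i b)) ∈
      normalSpan k N ε a := by
  induction i using multiIndex_induction with
  | zero =>
    intro m
    by_cases hm : m < N a b
    · exact mul_mem_normalSpan hm (IsNormal.letter _ b).eval_mem
    · rw [eval_letter_zero, hε a b m hm]
      exact zero_mem _
  | add_single i j ih =>
    intro m
    rw [eval_letter_add_single, mul_D_right]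
    exact add_mem (D_mem_normalSpan j (ih m)) (Submodule.smul_mem _ _ (ih _))

end

variable [AssocNConformalAlgebra k n C] {N : B → B → Fin n → ℕ} {ε : B → C}

/-- The rewriting step. Since the index `m'` grows while `m` decreases, the hypothesis on `x` has to
cover all `m'`. -/
theorem mul_mul_mem_normalSpan (hε : RespectsLocality k n N ε) (a b : B) (x : C)
    (hx : ∀ m' : Fin n → ℕ, NConformalAlgebra.mul (k := k) m' (ε b) x ∈ normalSpan k N ε b)
    (m : Fin n → ℕ) :
    ∀ m' : Fin n → ℕ, NConformalAlgebra.mul (k := k) m (ε a) (NConformalAlgebra.mul (k := k) m' (ε b) x) ∈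
      normalSpan k N ε a := by
  induction m using WellFoundedLT.induction with
  | ind m ih =>
    intro m'
    by_cases hm : m < N a b
    · exact mul_mem_normalSpan hm (hx m')
    · have key := AssocNConformalAlgebra.assoc_signedChoose (k := k) (ε a) (ε b) x m m'
      rw [hε a b m hm, ← Finset.add_sum_erase _ _ (Finset.mem_Iic.2 zero_le)] at key
      simp only [map_zero, LinearMap.zero_apply, signedChoose_zero_right, one_smul, tsub_zero,
        add_zero] at key
      -- The term `s = 0` has coefficient `1` and can be isolated; every other `s ≤ m` strictly
      -- lowers `m`.
      rw [eq_neg_of_add_eq_zero_left key.symm]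
      refine neg_mem (sum_mem fun s hs => Submodule.smul_mem _ _ (ih _ ?_ _))
      obtain ⟨hs0, hs⟩ := Finset.mem_erase.1 hs
      refine lt_of_le_of_ne tsub_le_self fun h => hs0 ?_
      have hle := Finset.mem_Iic.1 hs
      funext i
      have h1 : m i - s i = m i := congrFun h i
      have h2 : s i ≤ m i := hle i
      change s i = 0
      omega

theorem mul_eval_mem_normalSpan (hε : RespectsLocality k n N ε) {p : ConformalWord n B}
    (hp : IsNormal N p) : ∀ (a : B) (m : Fin n → ℕ),
    NConformalAlgebra.mul (k := k) m (ε a) (eval k ε p) ∈ normalSpan k N ε a := by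
  induction hp with
  | letter i b => exact fun a m => mul_letter_mem_normalSpan hε a b i m
  | mul b m' p hm hp ih =>
    intro a m
    rw [eval_mul_letter_zero]
    exact mul_mul_mem_normalSpan hε a b _ (ih b) m m'

variable (k) in
/-- The span of the values of all normal words. -/
def normalSpanTop (N : B → B → Fin n → ℕ) (ε : B → C) : Submodule k C :=
  Submodule.span k (Set.range fun p : {p : ConformalWord n B // IsNormal N p} => eval k ε p.1)

theorem normalSpan_le_normalSpanTop (h : B) : normalSpan k N ε h ≤ normalSpanTop k N ε :=
  Submodule.span_mono fun _ ⟨p, hp, _, hx⟩ => ⟨⟨p, hp⟩, hx⟩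

theorem letter_zero_mem_normalSpanTop (b : B) : ε b ∈ normalSpanTop k N ε :=
  Submodule.subset_span ⟨⟨letter 0 b, .letter 0 b⟩, eval_letter_zero ε b⟩

theorem D_mem_normalSpanTop (j : Fin n) {x : C} (hx : x ∈ normalSpanTop k N ε) :
    D (k := k) j x ∈ normalSpanTop k N ε := by
  suffices h : normalSpanTop k N ε ≤ (normalSpanTop k N ε).comap (D (k := k) j) from h hx
  refine Submodule.span_le.2 ?_
  rintro _ ⟨⟨p, hp⟩, rfl⟩
  exact normalSpan_le_normalSpanTop _ (D_mem_normalSpan j hp.eval_mem)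

theorem mul_letter_zero_mem_normalSpanTop (hε : RespectsLocality k n N ε) (a : B)
    (m : Fin n → ℕ) {x : C} (hx : x ∈ normalSpanTop k N ε) :
    NConformalAlgebra.mul (k := k) m (ε a) x ∈ normalSpanTop k N ε := by
  suffices h : normalSpanTop k N ε ≤
    (normalSpanTop k N ε).comap (NConformalAlgebra.mul (k := k) m (ε a)) from h hx
  refine Submodule.span_le.2 ?_
  rintro _ ⟨⟨p, hp⟩, rfl⟩
  exact normalSpan_le_normalSpanTop _ (mul_eval_mem_normalSpan hε hp a m)

theorem mul_mem_normalSpanTop (hε : RespectsLocality k n N ε) (m : Fin n → ℕ) {x y : C}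
    (hx : x ∈ normalSpanTop k N ε) (hy : y ∈ normalSpanTop k N ε) :
    NConformalAlgebra.mul (k := k) m x y ∈ normalSpanTop k N ε := by
  have hword : ∀ p, IsNormal N p → ∀ (m : Fin n → ℕ) (y), y ∈ normalSpanTop k N ε →
      NConformalAlgebra.mul (k := k) m (eval k ε p) y ∈ normalSpanTop k N ε := by
    intro p hp
    induction hp with
    | letter i b =>
      induction i using multiIndex_induction with
      | zero =>
        intro m y hy
        rw [eval_letter_zero]
        exact mul_letter_zero_mem_normalSpanTop hε b m hy
      | add_single i j ih =>
        intro m y hy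
        rw [eval_letter_add_single, D_left]
        exact Submodule.smul_mem _ _ (ih _ y hy)
    | mul a q p hq hp ih =>
      intro m y hy
      rw [eval_mul_letter_zero, AssocNConformalAlgebra.assoc_signedChoose]
      exact sum_mem fun s _ => Submodule.smul_mem _ _
        (mul_letter_zero_mem_normalSpanTop hε a _ (ih _ y hy))
  suffices h : normalSpanTop k N ε ≤
    (normalSpanTop k N ε).comap ((NConformalAlgebra.mul (k := k) m).flip y) from h hx
  refine Submodule.span_le.2 ?_
  rintro _ ⟨⟨p, hp⟩, rfl⟩
  exact hword p hp m y hy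

/-- An algebra generated by `ε`, with `ε` respecting the locality function, is spanned by the
values of the normal words. -/
theorem normalSpanTop_eq_top (hgen : IsGeneratedBy k n ε) (hε : RespectsLocality k n N ε) :
    normalSpanTop k N ε = ⊤ :=
  hgen _ letter_zero_mem_normalSpanTop (fun j _ hx => D_mem_normalSpanTop j hx)
    fun m _ hx _ hy => mul_mem_normalSpanTop hε m hx hy

end ConformalWord

theorem NConformalHom.map_eval {C' : Type t} [AddCommGroup C'] [Module k C']
    [NConformalAlgebra k n C] [NConformalAlgebra k n C'] (f : NConformalHom k n C C')
    {B : Type v} (ε : B → C) (p : ConformalWord n B) :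
    f.toLinearMap (p.eval k ε) = p.eval k (fun b => f.toLinearMap (ε b)) := by
  induction p with
  | letter i b =>
    induction i using multiIndex_induction with
    | zero => rw [ConformalWord.eval_letter_zero, ConformalWord.eval_letter_zero]
    | add_single i j ih =>
      rw [ConformalWord.eval_letter_add_single, ConformalWord.eval_letter_add_single, ← ih]
      exact f.map_D j _
  | mul p m q hp hq =>
    rw [ConformalWord.eval, ConformalWord.eval, ← hp, ← hq]
    exact f.map_mul m _ _

end Spanning

/-! ### Products of conformal algebras. -/

section Product

open NConformalAlgebra

variable {k : Type u} [Field k] {n : ℕ} {C : Type w} [AddCommGroup C] [Module k C]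
  {C' : Type t} [AddCommGroup C'] [Module k C']

instance NConformalAlgebra.instProd [NConformalAlgebra k n C] [NConformalAlgebra k n C'] :
    NConformalAlgebra k n (C × C') where
  mul (m : Fin n → ℕ) := LinearMap.mk₂ k
    (fun x y => (mul (k := k) (n := n) m x.1 y.1, mul (k := k) (n := n) m x.2 y.2))
    (by intros; ext <;> simp) (by intros; ext <;> simp) (by intros; ext <;> simp)
    (by intros; ext <;> simp)
  D i := (D (k := k) i).prodMap (D (k := k) i)
  D_comm i j := by
    have h := D_comm (k := k) (C := C) i j
    have h' := D_comm (k := k) (C := C') i j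
    ext x
    · simpa using LinearMap.congr_fun h x
    · simp
    · simp
    · simpa using LinearMap.congr_fun h' x
  locality a b := by
    obtain ⟨M, hM⟩ := locality (k := k) (n := n) a.1 b.1
    obtain ⟨M', hM'⟩ := locality (k := k) (n := n) a.2 b.2
    refine ⟨M ⊔ M', fun m hm => ?_⟩
    have h := hM m fun h => hm (lt_of_lt_of_le h le_sup_left)
    have h' := hM' m fun h => hm (lt_of_lt_of_le h le_sup_right)
    simp [h, h']
  D_mul i m a b := by
    ext <;> simp [D_mul]
  D_left i m a b := by
    ext <;> simp [D_left]

instance AssocNConformalAlgebra.instProd [AssocNConformalAlgebra k n C]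
    [AssocNConformalAlgebra k n C'] : AssocNConformalAlgebra k n (C × C') where
  assoc a b c m m' := by
    ext
    · simpa [mul, Prod.fst_sum] using AssocNConformalAlgebra.assoc (k := k) a.1 b.1 c.1 m m'
    · simpa [mul, Prod.snd_sum] using AssocNConformalAlgebra.assoc (k := k) a.2 b.2 c.2 m m'

variable (k n C C') in
/-- The first projection of a product of `n`-conformal algebras. -/
def NConformalHom.fst [NConformalAlgebra k n C] [NConformalAlgebra k n C'] :
    NConformalHom k n (C × C') C where
  toLinearMap := LinearMap.fst k C C'
  map_mul _ _ _ := rfl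
  map_D _ _ := rfl

variable (k n C C') in
/-- The second projection of a product of `n`-conformal algebras. -/
def NConformalHom.snd [NConformalAlgebra k n C] [NConformalAlgebra k n C'] :
    NConformalHom k n (C × C') C' where
  toLinearMap := LinearMap.snd k C C'
  map_mul _ _ _ := rfl
  map_D _ _ := rfl

theorem RespectsLocality.prodMk [NConformalAlgebra k n C] [NConformalAlgebra k n C']
    {B : Type v} {N : B → B → Fin n → ℕ} {ε : B → C} {ε' : B → C'}
    (h : RespectsLocality k n N ε) (h' : RespectsLocality k n N ε') :
    RespectsLocality k n N fun b => (ε b, ε' b) := fun a b m hm =>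
  Prod.ext (h a b m hm) (h' a b m hm)

end Product

/-! ### The model: operators on the space of normal words. -/

section Model

open ConformalWord

variable {k : Type u} [Field k] {n : ℕ} {B : Type v} {N : B → B → Fin n → ℕ}

variable (k N) in
/-- The vector space with basis the normal words. As an `n`-conformal algebra the basis vector of
`a₁ ⟨m¹⟩ (a₂ ⟨m²⟩ ⋯ D^i b)` will be `D^i` applied to the left normed product
`((a₁ ⟨m¹⟩ a₂) ⟨m²⟩ ⋯) b`. -/
def FreeModel : Type (max u v) := {p : ConformalWord n B // IsNormal N p} →₀ k

namespace FreeModel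

noncomputable instance : AddCommGroup (FreeModel k N) :=
  inferInstanceAs (AddCommGroup ({p : ConformalWord n B // IsNormal N p} →₀ k))

noncomputable instance : Module k (FreeModel k N) :=
  inferInstanceAs (Module k ({p : ConformalWord n B // IsNormal N p} →₀ k))

variable (k N) in
/-- The defining basis of `FreeModel k N`. -/
noncomputable def basis :
    Module.Basis {p : ConformalWord n B // IsNormal N p} k (FreeModel k N) :=
  .ofRepr (LinearEquiv.refl k _)

open Classical in
variable (k N) in
/-- The basis vector of a normal word; `0` for words that are not normal. -/
noncomputable def word (p : ConformalWord n B) : FreeModel k N :=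
  if h : IsNormal N p then basis k N ⟨p, h⟩ else 0

theorem word_of_isNormal {p : ConformalWord n B} (hp : IsNormal N p) :
    word k N p = basis k N ⟨p, hp⟩ := by
  rw [word, dif_pos hp]

/-- The linear map with prescribed values on the normal words. -/
noncomputable def extend {V : Type*} [AddCommGroup V] [Module k V] (X : ConformalWord n B → V) :
    FreeModel k N →ₗ[k] V :=
  (basis k N).constr k fun p => X p.1

theorem extend_word {V : Type*} [AddCommGroup V] [Module k V] (X : ConformalWord n B → V)
    {p : ConformalWord n B} (hp : IsNormal N p) : extend X (word k N p) = X p := by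
  rw [word_of_isNormal hp, extend, Module.Basis.constr_basis]

theorem span_word : Submodule.span k {x | ∃ p, IsNormal N p ∧ word k N p = x} = ⊤ := by
  rw [← (basis k N).span_eq]
  congr 1
  ext x
  constructor
  · rintro ⟨p, hp, rfl⟩
    exact ⟨⟨p, hp⟩, (word_of_isNormal hp).symm⟩
  · rintro ⟨⟨p, hp⟩, rfl⟩
    exact ⟨p, hp, word_of_isNormal hp⟩

theorem ext_word {V : Type*} [AddCommGroup V] [Module k V] {f g : FreeModel k N →ₗ[k] V}
    (h : ∀ p, IsNormal N p → f (word k N p) = g (word k N p)) : f = g :=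
  LinearMap.ext_on span_word fun _ ⟨p, hp, hx⟩ => hx ▸ h p hp

/-- The linear map `p ↦ a ⟨q⟩ p` on basis vectors. -/
noncomputable def cons (a : B) (q : Fin n → ℕ) : Module.End k (FreeModel k N) :=
  extend fun p => word k N (mul (letter 0 a) q p)

theorem cons_word (a : B) (q : Fin n → ℕ) {p : ConformalWord n B} (hp : IsNormal N p) :
    cons a q (word k N p) = word k N (mul (letter 0 a) q p) :=
  extend_word _ hp

theorem cons_word_of_not_lt {a : B} {q : Fin n → ℕ} {p : ConformalWord n B}
    (hp : IsNormal N p) (hq : ¬ q < N a p.head) : cons a q (word k N p) = 0 := by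
  rw [cons_word a q hp, word, dif_neg]
  rintro (_ | ⟨_, _, _, h, _⟩)
  exact hq h

theorem ext_cons {V : Type*} [AddCommGroup V] [Module k V] {f g : FreeModel k N →ₗ[k] V}
    (letter : ∀ i b, f (word k N (letter i b)) = g (word k N (letter i b)))
    (cons : ∀ a q p, IsNormal N p → f (word k N p) = g (word k N p) →
      f (cons a q (word k N p)) = g (cons a q (word k N p))) : f = g := by
  refine ext_word fun p hp => ?_
  induction hp with
  | letter i b => exact letter i b
  | mul a q p hq hp ih =>
    rw [← cons_word a q hp]
    exact cons a q p hp ih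

theorem induction_cons {P : FreeModel k N → Prop} (zero : P 0)
    (add : ∀ x y, P x → P y → P (x + y)) (smul : ∀ (c : k) x, P x → P (c • x))
    (letter : ∀ i b, P (word k N (letter i b))) (cons : ∀ a q x, P x → P (cons a q x))
    (x : FreeModel k N) : P x := by
  have hx : x ∈ Submodule.span k {x | ∃ p, IsNormal N p ∧ word k N p = x} := by
    rw [span_word]
    trivial
  induction hx using Submodule.span_induction with
  | mem x hx =>
    obtain ⟨p, hp, rfl⟩ := hx
    induction hp with
    | letter i b => exact letter i b
    | mul a q p hq hp ih =>
      rw [← cons_word a q hp]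
      exact cons a q _ ih
  | zero => exact zero
  | add x y _ _ hx hy => exact add x y hx hy
  | smul c x _ hx => exact smul c x hx

variable (k N) in
/-- The span of the normal words with first letter `h`. -/
noncomputable def headSpan (h : B) : Submodule k (FreeModel k N) :=
  Submodule.span k {x | ∃ p, IsNormal N p ∧ p.head = h ∧ word k N p = x}

theorem word_mem_headSpan (p : ConformalWord n B) : word k N p ∈ headSpan k N p.head := by
  by_cases hp : IsNormal N p
  · exact Submodule.subset_span ⟨p, hp, rfl, rfl⟩
  · rw [word, dif_neg hp]
    exact zero_mem _

theorem cons_mem_headSpan (a : B) (q : Fin n → ℕ) (x : FreeModel k N) :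
    cons a q x ∈ headSpan k N a := by
  have h : (⊤ : Submodule k (FreeModel k N)) ≤ (headSpan k N a).comap (cons a q) := by
    rw [← span_word, Submodule.span_le]
    rintro _ ⟨p, hp, rfl⟩
    rw [SetLike.mem_coe, Submodule.mem_comap, cons_word a q hp]
    exact word_mem_headSpan (mul (letter 0 a) q p)
  exact h trivial

theorem cons_eq_zero {a h : B} {q : Fin n → ℕ} (hq : ¬ q < N a h) {x : FreeModel k N}
    (hx : x ∈ headSpan k N h) : cons a q x = 0 := by
  suffices hle : headSpan k N h ≤ LinearMap.ker (cons a q) from LinearMap.mem_ker.1 (hle hx)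
  refine Submodule.span_le.2 ?_
  rintro _ ⟨p, hp, rfl, rfl⟩
  exact LinearMap.mem_ker.2 (cons_word_of_not_lt hp hq)

variable (k N) in
/-- The values of `raise j` on words. -/
noncomputable def raiseWord (j : Fin n) : ConformalWord n B → FreeModel k N
  | letter i b => (i j : k) • word k N (letter (i - Pi.single j 1) b)
  | mul p m q => cons p.head (m + Pi.single j 1) (word k N q) + cons p.head m (raiseWord j q)

/-- The operator which acts on `a₁ ⟨m¹⟩ (a₂ ⟨m²⟩ ⋯ D^i b)` by the sum of the terms with
one of the `mᵗ` raised by `e_j` and of the derivative of `D^i`. -/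
noncomputable def raise (j : Fin n) : Module.End k (FreeModel k N) :=
  extend (raiseWord k N j)

variable (k N) in
/-- The values of `der j` on words. -/
noncomputable def derWord (j : Fin n) : ConformalWord n B → FreeModel k N
  | letter i b => word k N (letter (i + Pi.single j 1) b)
  | mul p m q => cons p.head m (derWord j q)

/-- The derivation `D_j`. -/
noncomputable def der (j : Fin n) : Module.End k (FreeModel k N) :=
  extend (derWord k N j)

theorem raise_letter (j : Fin n) (i : Fin n → ℕ) (b : B) :
    raise j (word k N (letter i b)) = (i j : k) • word k N (letter (i - Pi.single j 1) b) :=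
  extend_word _ (.letter i b)

theorem der_letter (j : Fin n) (i : Fin n → ℕ) (b : B) :
    der j (word k N (letter i b)) = word k N (letter (i + Pi.single j 1) b) :=
  extend_word _ (.letter i b)

theorem raiseWord_mem_headSpan (j : Fin n) (p : ConformalWord n B) :
    raiseWord k N j p ∈ headSpan k N p.head := by
  cases p with
  | letter i b => exact Submodule.smul_mem _ _ (word_mem_headSpan (letter (i - Pi.single j 1) b))
  | mul p m q => exact add_mem (cons_mem_headSpan _ _ _) (cons_mem_headSpan _ _ _)

theorem derWord_mem_headSpan (j : Fin n) (p : ConformalWord n B) :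
    derWord k N j p ∈ headSpan k N p.head := by
  cases p with
  | letter i b => exact word_mem_headSpan (letter (i + Pi.single j 1) b)
  | mul p m q => exact cons_mem_headSpan _ _ _

/-- The defining recursion, extended to the case where `cons a q` kills the word. There both sides
vanish because `raise j` keeps the first letter and a larger index stays outside the locality bound.
-/
theorem raise_cons (j : Fin n) (a : B) (q : Fin n → ℕ) (x : FreeModel k N) :
    raise j (cons a q x) = cons a (q + Pi.single j 1) x + cons a q (raise j x) := by
  suffices h : raise j * cons a q =
      (cons a (q + Pi.single j 1) + cons a q * raise j : Module.End k (FreeModel k N)) from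
    LinearMap.congr_fun h x
  refine ext_word fun p hp => ?_
  simp only [Module.End.mul_apply, LinearMap.add_apply]
  have hr : raise j (word k N p) = raiseWord k N j p := extend_word _ hp
  rw [hr]
  by_cases hq : q < N a p.head
  · rw [cons_word a q hp, raise, extend_word _ (.mul a q p hq hp)]
    rfl
  · have hq' : ¬ q + Pi.single j 1 < N a p.head := fun h => hq (lt_of_le_of_lt le_self_add h)
    rw [cons_word_of_not_lt hp hq, cons_word_of_not_lt hp hq',
      cons_eq_zero hq (raiseWord_mem_headSpan j p), map_zero, add_zero]

theorem der_cons (j : Fin n) (a : B) (q : Fin n → ℕ) (x : FreeModel k N) :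
    der j (cons a q x) = cons a q (der j x) := by
  suffices h : der j * cons a q = (cons a q * der j : Module.End k (FreeModel k N)) from
    LinearMap.congr_fun h x
  refine ext_word fun p hp => ?_
  simp only [Module.End.mul_apply]
  have hr : der j (word k N p) = derWord k N j p := extend_word _ hp
  rw [hr]
  by_cases hq : q < N a p.head
  · rw [cons_word a q hp, der, extend_word _ (.mul a q p hq hp)]
    rfl
  · rw [cons_word_of_not_lt hp hq, cons_eq_zero hq (derWord_mem_headSpan j p), map_zero]

theorem raise_mem_headSpan (j : Fin n) {h : B} {x : FreeModel k N} (hx : x ∈ headSpan k N h) :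
    raise j x ∈ headSpan k N h := by
  suffices hle : headSpan k N h ≤ (headSpan k N h).comap (raise j) from hle hx
  refine Submodule.span_le.2 ?_
  rintro _ ⟨p, hp, rfl, rfl⟩
  rw [SetLike.mem_coe, Submodule.mem_comap, raise, extend_word _ hp]
  exact raiseWord_mem_headSpan j p

theorem der_comm (i j : Fin n) :
    der i * der j = (der j * der i : Module.End k (FreeModel k N)) := by
  refine ext_cons (fun l b => ?_) fun a q p _ ih => ?_
  · simp only [Module.End.mul_apply, der_letter, add_right_comm]
  · simp only [Module.End.mul_apply, der_cons] at ih ⊢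
    rw [ih]

theorem raise_comm (i j : Fin n) :
    raise i * raise j = (raise j * raise i : Module.End k (FreeModel k N)) := by
  refine ext_cons (fun l b => ?_) fun a q p _ ih => ?_
  · simp only [Module.End.mul_apply, raise_letter, map_smul, smul_smul]
    rw [tsub_right_comm]
    congr 1
    by_cases h : i = j
    · rw [h]
    · simp [h, Ne.symm h, mul_comm]
  · simp only [Module.End.mul_apply, raise_cons, map_add] at ih ⊢
    rw [ih, add_right_comm q]
    abel

/-- The Weyl relation between multiplication by `w₁ - z` and differentiation in `z` of a function
whose outer derivatives are in `z`. -/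
theorem raise_der (i j : Fin n) :
    raise i * der j =
      (der j * raise i + if i = j then 1 else 0 : Module.End k (FreeModel k N)) := by
  refine ext_cons (fun l b => ?_) fun a q p _ ih => ?_
  · simp only [Module.End.mul_apply, LinearMap.add_apply, raise_letter, der_letter, map_smul]
    by_cases h : i = j
    · subst h
      rw [add_tsub_cancel_right, if_pos rfl, Module.End.one_apply]
      by_cases hl : l i = 0
      · simp [hl]
      · rw [tsub_single_add_single hl]
        simp [add_smul]
    · rw [add_single_tsub_single_of_ne (Ne.symm h)]
      simp [h]
  · simp only [Module.End.mul_apply, LinearMap.add_apply, raise_cons, der_cons, map_add] at ih ⊢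
    rw [ih, map_add, add_assoc]
    congr 2
    split_ifs <;> simp

/-- The products `a ⟨l⟩ x` with a generator `a`. -/
noncomputable def genMul (b : B) (l : Fin n → ℕ) : Module.End k (FreeModel k N) :=
  monomialProd raise l * cons b 0

theorem genMul_zero (b : B) : genMul b 0 = (cons b 0 : Module.End k (FreeModel k N)) := by
  rw [genMul, monomialProd_zero, one_mul]

theorem genMul_add_single (b : B) (l : Fin n → ℕ) (j : Fin n) :
    genMul b (l + Pi.single j 1) = (raise j * genMul b l : Module.End k (FreeModel k N)) := by
  rw [genMul, monomialProd_add_single raise_comm, mul_assoc, genMul]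

theorem genMul_mem_headSpan (b : B) (l : Fin n → ℕ) (x : FreeModel k N) :
    genMul b l x ∈ headSpan k N b := by
  induction l using multiIndex_induction with
  | zero =>
    rw [genMul_zero]
    exact cons_mem_headSpan b 0 x
  | add_single l j ih =>
    rw [genMul_add_single]
    exact raise_mem_headSpan j ih

theorem der_genMul (j : Fin n) (b : B) (l : Fin n → ℕ) :
    der j * genMul b l = (genMul b l * der j -
      (l j : k) • genMul b (l - Pi.single j 1) : Module.End k (FreeModel k N)) := by
  -- The sign in `Y = -der` turns the Weyl relation into the form `[Y_i, X_j] = δ_{ij}`.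
  have h := mul_monomialProd (X := raise) (Y := fun j => (-der j : Module.End k (FreeModel k N)))
    raise_comm (fun i j => by
      rw [neg_mul, mul_neg, raise_der]
      simp only [eq_comm]
      abel) j l
  have hc : der j * cons b 0 = (cons b 0 * der j : Module.End k (FreeModel k N)) :=
    LinearMap.ext fun x => der_cons j b 0 x
  have h' : der j * monomialProd raise l = (monomialProd raise l * der j -
      (l j : k) • monomialProd raise (l - Pi.single j 1) : Module.End k (FreeModel k N)) := by
    rw [← neg_inj, ← neg_mul, h, mul_neg, ← nsmul_eq_mul, ← Nat.cast_smul_eq_nsmul k]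
    abel
  simp only [genMul]
  rw [← mul_assoc, h', sub_mul, mul_assoc, hc, smul_mul_assoc, mul_assoc]

/-! ### Left multiplication by arbitrary elements, Leibniz rule and associativity. -/

variable (k N) in
/-- Families of operators, such as `l ↦ (x ↦ u ⟨l⟩ x)`. -/
abbrev Series : Type (max u v) := (Fin n → ℕ) → Module.End k (FreeModel k N)

namespace Series

/-- The operator on families which describes the passage from `u` to `D_j u`. -/
noncomputable def nabla (j : Fin n) : Module.End k (Series k N) where
  toFun F l := -(l j : k) • F (l - Pi.single j 1)
  map_add' F G := by
    funext l
    simp only [Pi.add_apply, smul_add]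
  map_smul' c F := by
    funext l
    simp only [Pi.smul_apply, RingHom.id_apply]
    rw [smul_comm]

/-- The operator on families which describes the passage from `u` to `raise j u`. -/
noncomputable def raise (j : Fin n) : Module.End k (Series k N) where
  toFun F l := FreeModel.raise j * F l - F (l + Pi.single j 1)
  map_add' F G := by
    funext l
    simp only [Pi.add_apply, mul_add]
    abel
  map_smul' c F := by
    funext l
    simp only [Pi.smul_apply, RingHom.id_apply, mul_smul_comm]
    rw [smul_sub]

/-- The operator on families which describes the passage from `u` to `cons a q u`. -/
noncomputable def cons (a : B) (q : Fin n → ℕ) : Module.End k (Series k N) where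
  toFun F l := FreeModel.cons a q * F l
  map_add' F G := by
    funext l
    simp only [Pi.add_apply, mul_add]
  map_smul' c F := by
    funext l
    simp only [Pi.smul_apply, RingHom.id_apply, mul_smul_comm]

theorem nabla_apply (j : Fin n) (F : Series k N) (l : Fin n → ℕ) :
    nabla j F l = -(l j : k) • F (l - Pi.single j 1) := rfl

theorem raise_apply (j : Fin n) (F : Series k N) (l : Fin n → ℕ) :
    raise j F l = FreeModel.raise j * F l - F (l + Pi.single j 1) := rfl

theorem cons_apply (a : B) (q : Fin n → ℕ) (F : Series k N) (l : Fin n → ℕ) :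
    cons a q F l = FreeModel.cons a q * F l := rfl

theorem nabla_comm (i j : Fin n) :
    nabla i * nabla j = (nabla j * nabla i : Module.End k (Series k N)) := by
  refine LinearMap.ext fun F => funext fun l => ?_
  simp only [Module.End.mul_apply, nabla_apply, smul_smul]
  rw [tsub_right_comm]
  congr 1
  by_cases h : i = j
  · rw [h]
  · simp [h, Ne.symm h, mul_comm]

theorem raise_nabla (i j : Fin n) :
    raise i * nabla j =
      (nabla j * raise i + if i = j then 1 else 0 : Module.End k (Series k N)) := by
  refine LinearMap.ext fun F => funext fun l => ?_
  simp only [Module.End.mul_apply, LinearMap.add_apply, Pi.add_apply, nabla_apply, raise_apply,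
    mul_smul_comm]
  by_cases h : i = j
  · subst h
    rw [add_tsub_cancel_right, if_pos rfl, Module.End.one_apply]
    by_cases hl : l i = 0
    · simp only [hl, Pi.single_eq_same, Nat.cast_zero, Nat.cast_one, zero_add]
      module
    · rw [tsub_single_add_single hl]
      simp only [Pi.single_eq_same, Nat.cast_add, Nat.cast_one]
      module
  · rw [add_single_tsub_single_of_ne h]
    simp [h, Ne.symm h]
    module

end Series

variable (k N) in
/-- The values of `leftMul` on words. -/
noncomputable def leftMulWord : ConformalWord n B → Series k N
  | letter i b => monomialProd Series.nabla i (genMul b)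
  | mul p m q => Series.cons p.head m (leftMulWord q)

/-- The left multiplications: `leftMul u l x` is the product `u ⟨l⟩ x`. -/
noncomputable def leftMul : FreeModel k N →ₗ[k] Series k N :=
  extend (leftMulWord k N)

theorem leftMul_letter (i : Fin n → ℕ) (b : B) :
    leftMul (word k N (letter i b)) = monomialProd Series.nabla i (genMul b) :=
  extend_word _ (.letter i b)

theorem leftMul_letter_zero (b : B) : leftMul (word k N (letter 0 b)) = genMul b := by
  rw [leftMul_letter, monomialProd_zero, Module.End.one_apply]

theorem leftMul_letter_add_single (i : Fin n → ℕ) (j : Fin n) (b : B) :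
    leftMul (word k N (letter (i + Pi.single j 1) b)) =
      Series.nabla j (leftMul (word k N (letter i b))) := by
  rw [leftMul_letter, leftMul_letter, monomialProd_add_single Series.nabla_comm,
    Module.End.mul_apply]

theorem leftMulWord_mem_headSpan (p : ConformalWord n B) (l : Fin n → ℕ) (x : FreeModel k N) :
    leftMulWord k N p l x ∈ headSpan k N p.head := by
  cases p with
  | letter i b =>
    rw [leftMulWord]
    induction i using multiIndex_induction generalizing l with
    | zero =>
      rw [monomialProd_zero]
      exact genMul_mem_headSpan b l x
    | add_single i j ih =>
      rw [monomialProd_add_single Series.nabla_comm, Module.End.mul_apply, Series.nabla_apply]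
      exact Submodule.smul_mem _ _ (ih _)
  | mul p m q =>
    change cons p.head m (leftMulWord k N q l x) ∈ headSpan k N p.head
    exact cons_mem_headSpan _ _ _

/-- A letter in front of `u` sees only the first letter of `u`, which is also the first letter of `u
⟨l⟩ x`. Hence the locality condition that kills the left side kills the right side too. -/
theorem leftMul_cons (a : B) (q : Fin n → ℕ) (x : FreeModel k N) :
    leftMul (cons a q x) = Series.cons a q (leftMul x) := by
  suffices h : (leftMul (k := k) (N := N)).comp (cons a q) =
      ((Series.cons a q : Module.End k (Series k N)).comp leftMul :
        FreeModel k N →ₗ[k] Series k N) from LinearMap.congr_fun h x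
  refine ext_word fun p hp => ?_
  simp only [LinearMap.comp_apply]
  have hr : leftMul (word k N p) = leftMulWord k N p := extend_word _ hp
  rw [hr]
  by_cases hq : q < N a p.head
  · rw [cons_word a q hp, leftMul, extend_word _ (.mul a q p hq hp)]
    rfl
  · rw [cons_word_of_not_lt hp hq, map_zero]
    refine funext fun l => LinearMap.ext fun y => ?_
    exact (cons_eq_zero hq (leftMulWord_mem_headSpan p l y)).symm

theorem leftMul_der (j : Fin n) (x : FreeModel k N) :
    leftMul (der j x) = Series.nabla j (leftMul x) := by
  suffices h : (leftMul (k := k) (N := N)).comp (der j) = ((Series.nabla j).comp leftMul :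
    FreeModel k N →ₗ[k] Series k N) from LinearMap.congr_fun h x
  refine ext_cons (fun i b => ?_) fun a q p _ ih => ?_
  · simp only [LinearMap.comp_apply]
    rw [der_letter, leftMul_letter_add_single]
  · simp only [LinearMap.comp_apply] at ih ⊢
    rw [der_cons, leftMul_cons, leftMul_cons, ih]
    funext l
    simp only [Series.nabla_apply, Series.cons_apply, mul_smul_comm]

/-- If `w` is the last variable of `u`, this is `w₁ - w = (w₁ - z) - (w - z)`: the first term raises
the whole product, the second raises its index. This identity is the source of associativity. -/
theorem leftMul_raise (j : Fin n) (x : FreeModel k N) :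
    leftMul (raise j x) = Series.raise j (leftMul x) := by
  suffices h : (leftMul (k := k) (N := N)).comp (raise j) = ((Series.raise j).comp leftMul :
    FreeModel k N →ₗ[k] Series k N) from LinearMap.congr_fun h x
  refine ext_cons (fun i b => ?_) fun a q p _ ih => ?_
  · simp only [LinearMap.comp_apply]
    have h := LinearMap.congr_fun (mul_monomialProd (X := Series.nabla)
      (Y := (Series.raise : Fin n → Module.End k (Series k N)))
      Series.nabla_comm Series.raise_nabla j i) (genMul b)
    -- A bare generator has a single variable, so its raise is zero; only the commutator with the
    -- `nabla` monomial survives.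
    have h0 : Series.raise j (fun l => (genMul b l : Module.End k (FreeModel k N))) = 0 := by
      funext l
      rw [Series.raise_apply, genMul_add_single, sub_self]
      rfl
    rw [raise_letter, map_smul, leftMul_letter, leftMul_letter]
    rw [Module.End.mul_apply, LinearMap.add_apply, Module.End.mul_apply, h0, map_zero, zero_add,
      ← nsmul_eq_mul, ← Nat.cast_smul_eq_nsmul k] at h
    exact h.symm
  · simp only [LinearMap.comp_apply] at ih ⊢
    rw [raise_cons, map_add, leftMul_cons, leftMul_cons, leftMul_cons, ih]
    refine funext fun l => LinearMap.ext fun y => ?_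
    simp only [Series.raise_apply, Series.cons_apply, Pi.add_apply, LinearMap.add_apply,
      LinearMap.sub_apply, Module.End.mul_apply, raise_cons, map_sub]
    abel

theorem der_leftMul (j : Fin n) (u : FreeModel k N) (l : Fin n → ℕ) (x : FreeModel k N) :
    der j (leftMul u l x) = leftMul (der j u) l x + leftMul u l (der j x) := by
  rw [leftMul_der]
  induction u using induction_cons generalizing l with
  | zero => simp
  | add u v hu hv =>
    simp only [map_add, Pi.add_apply, LinearMap.add_apply, hu, hv]
    abel
  | smul c u hu => simp only [map_smul, Pi.smul_apply, LinearMap.smul_apply, hu, smul_add]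
  | letter i b =>
    induction i using multiIndex_induction generalizing l with
    | zero =>
      have h := LinearMap.congr_fun (der_genMul (k := k) (N := N) j b l) x
      simp only [Module.End.mul_apply, LinearMap.sub_apply, LinearMap.smul_apply] at h
      rw [leftMul_letter_zero, h, Series.nabla_apply, LinearMap.smul_apply]
      module
    | add_single i j' ih =>
      have h := LinearMap.congr_fun (congrFun (LinearMap.congr_fun
        (Series.nabla_comm (k := k) (N := N) j j') (leftMul (word k N (.letter i b)))) l) x
      rw [leftMul_letter_add_single]
      rw [Module.End.mul_apply, Module.End.mul_apply] at h
      rw [h, Series.nabla_apply j', Series.nabla_apply j', LinearMap.smul_apply, map_smul, ih,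
        smul_add]
      rfl
  | cons a q u hu =>
    rw [leftMul_cons]
    have h := hu l
    simp only [Series.nabla_apply, Series.cons_apply, Module.End.mul_apply, LinearMap.smul_apply]
      at h ⊢
    rw [der_cons, h, map_add, map_smul]

/-- For a generator `u`, each step in `m` is one application of `leftMul_raise`, and Pascal's rule
assembles the sum. Derivatives of generators follow from absorption, and `cons` commutes with both
sides. -/
theorem leftMul_leftMul (u v x : FreeModel k N) (m m' : Fin n → ℕ) :
    leftMul (leftMul u m v) m' x = ∑ s ∈ Finset.Iic m,
      signedChoose k m s • leftMul u (m - s) (leftMul v (m' + s) x) := by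
  induction u using induction_cons generalizing m m' with
  | zero => simp
  | add u w hu hw =>
    simp only [map_add, Pi.add_apply, LinearMap.add_apply, hu, hw, smul_add,
      Finset.sum_add_distrib]
  | smul c u hu =>
    simp only [map_smul, Pi.smul_apply, LinearMap.smul_apply, hu, Finset.smul_sum]
    exact Finset.sum_congr rfl fun s _ => smul_comm _ _ _
  | letter i b =>
    induction i using multiIndex_induction generalizing m m' with
    | zero =>
      rw [leftMul_letter_zero]
      induction m using multiIndex_induction generalizing m' with
      | zero =>
        have h0 : Finset.Iic (0 : Fin n → ℕ) = {0} := Finset.Iic_bot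
        rw [h0, Finset.sum_singleton, signedChoose_zero_right, one_smul, tsub_zero, add_zero,
          genMul_zero, leftMul_cons]
        rfl
      | add_single m j ih =>
        refine Eq.trans ?_ (sum_signedChoose_add_single (k := k) m j fun s =>
          genMul b (m + Pi.single j 1 - s) (leftMul v (m' + s) x)).symm
        rw [genMul_add_single, Module.End.mul_apply, leftMul_raise, Series.raise_apply,
          LinearMap.sub_apply, Module.End.mul_apply, ih, ih, map_sum, ← Finset.sum_sub_distrib]
        refine Finset.sum_congr rfl fun s hs => ?_
        rw [smul_sub, tsub_add_eq_add_tsub (Finset.mem_Iic.1 hs) |>.symm, genMul_add_single,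
          Module.End.mul_apply, map_smul, add_tsub_add_eq_tsub_right, add_right_comm, add_assoc m' s]
    | add_single i j ih =>
      rw [leftMul_letter_add_single, Series.nabla_apply, LinearMap.smul_apply, map_smul,
        Pi.smul_apply, LinearMap.smul_apply, ih, Finset.smul_sum]
      -- The coefficients vanish on the added indices, so both sums run over the same set.
      have hsub : Finset.Iic (m - Pi.single j 1) ⊆ Finset.Iic m :=
        Finset.Iic_subset_Iic.2 tsub_le_self
      rw [Finset.sum_subset hsub fun s _ hs => by
        rw [signedChoose_eq_zero (by simpa using hs), zero_smul, smul_zero]]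
      refine Finset.sum_congr rfl fun s _ => ?_
      rw [Series.nabla_apply, LinearMap.smul_apply, smul_smul, smul_smul, mul_neg,
        signedChoose_mul_tsub, tsub_right_comm, neg_mul]
  | cons a q u hu =>
    simp only [leftMul_cons, Series.cons_apply, Module.End.mul_apply, hu, map_sum, map_smul]

end FreeModel

end Model

/-! ### Locality in the model and its algebra structure. -/

section ModelAlgebra

open ConformalWord

variable {k : Type u} [Field k] {n : ℕ} {B : Type v} {N : B → B → Fin n → ℕ}

namespace FreeModel

variable (k N) in
/-- The span of the normal words with the property `P`. -/
noncomputable def wordSpan (P : ConformalWord n B → Prop) : Submodule k (FreeModel k N) :=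
  Submodule.span k {x | ∃ p, IsNormal N p ∧ P p ∧ word k N p = x}

theorem word_mem_wordSpan {P : ConformalWord n B → Prop} {p : ConformalWord n B} (hp : P p) :
    word k N p ∈ wordSpan k N P := by
  by_cases h : IsNormal N p
  · exact Submodule.subset_span ⟨p, h, hp, rfl⟩
  · rw [word, dif_neg h]
    exact zero_mem _

theorem wordSpan_mono {P Q : ConformalWord n B → Prop} (h : ∀ p, P p → Q p) :
    wordSpan k N P ≤ wordSpan k N Q :=
  Submodule.span_mono fun _ ⟨p, hp, hP, hx⟩ => ⟨p, hp, h p hP, hx⟩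

theorem wordSpan_le {P : ConformalWord n B → Prop} {S : Submodule k (FreeModel k N)}
    (h : ∀ p, IsNormal N p → P p → word k N p ∈ S) : wordSpan k N P ≤ S := by
  refine Submodule.span_le.2 ?_
  rintro _ ⟨p, hp, hP, rfl⟩
  exact h p hp hP

theorem apply_mem_of_mem_wordSpan {V : Type*} [AddCommGroup V] [Module k V]
    {f : FreeModel k N →ₗ[k] V} {P : ConformalWord n B → Prop} {S : Submodule k V}
    (h : ∀ p, IsNormal N p → P p → f (word k N p) ∈ S) {x : FreeModel k N}
    (hx : x ∈ wordSpan k N P) : f x ∈ S :=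
  (wordSpan_le (S := S.comap f) h) hx

theorem cons_mem_wordSpan {P Q : ConformalWord n B → Prop} {a : B} {q : Fin n → ℕ}
    (h : ∀ p, q < N a p.head → P p → Q (mul (letter 0 a) q p)) {x : FreeModel k N}
    (hx : x ∈ wordSpan k N P) : cons a q x ∈ wordSpan k N Q := by
  refine apply_mem_of_mem_wordSpan (fun p hp hP => ?_) hx
  by_cases hq : q < N a p.head
  · rw [cons_word a q hp]
    exact word_mem_wordSpan (h p hq hP)
  · rw [cons_word_of_not_lt hp hq]
    exact zero_mem _

end FreeModel

namespace ConformalWord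

/-- A degree which is lowered by the operators `FreeModel.raise j`. -/
def weight (N : B → B → Fin n → ℕ) : ConformalWord n B → ℕ
  | letter i _ => ∑ j, i j
  | mul p m q => ∑ j, (N p.head q.head j - m j) + weight N q

/-- The number of factors of a right normed word, minus one. -/
def length : ConformalWord n B → ℕ
  | letter _ _ => 0
  | mul _ _ q => length q + 1

/-- A degree with respect to which the values of normal words are triangular. -/
def depth : ConformalWord n B → ℕ
  | letter _ _ => 0
  | mul _ m q => depth q + (length q + 1) * ∑ j, m j

end ConformalWord

namespace FreeModel

/-- Raising an index uses up room below the locality bound, and words without room vanish. The first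
letter is tracked because the weight of a longer word depends on it through `N`. -/
theorem raise_word_mem_weight (j : Fin n) {p : ConformalWord n B} (hp : IsNormal N p) :
    raise j (word k N p) ∈
      wordSpan k N fun q => q.head = p.head ∧ q.weight N < p.weight N := by
  induction hp with
  | letter i b =>
    rw [raise_letter]
    by_cases hi : i j = 0
    · simp [hi]
    · refine Submodule.smul_mem _ _ (word_mem_wordSpan ⟨rfl, ?_⟩)
      refine Finset.sum_lt_sum (fun x _ => Nat.sub_le _ _) ⟨j, Finset.mem_univ j, ?_⟩
      simp only [Pi.sub_apply, Pi.single_eq_same]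
      omega
  | mul a m p hm hp ih =>
    rw [← cons_word a m hp, raise_cons]
    refine add_mem ?_ ?_
    · refine cons_mem_wordSpan (P := fun q => q = p) ?_ (word_mem_wordSpan rfl)
      rintro q hq rfl
      refine ⟨rfl, Nat.add_lt_add_right ?_ _⟩
      have hj : m j + 1 ≤ N a q.head j := by simpa using hq.le j
      refine Finset.sum_lt_sum (fun x _ => ?_) ⟨j, Finset.mem_univ j, ?_⟩
      · exact Nat.sub_le_sub_left (Nat.le_add_right _ _) _
      · simp only [ConformalWord.head, Pi.add_apply, Pi.single_eq_same]
        omega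
    · refine cons_mem_wordSpan ?_ ih
      rintro q _ ⟨hq, hq'⟩
      refine ⟨rfl, ?_⟩
      simp only [ConformalWord.weight, ConformalWord.head, hq]
      omega

theorem monomialProd_raise_add_single (l : Fin n → ℕ) (j : Fin n) (x : FreeModel k N) :
    monomialProd raise (l + Pi.single j 1) x = monomialProd raise l (raise j x) := by
  induction l using multiIndex_induction with
  | zero => rw [monomialProd_add_single raise_comm, monomialProd_zero, mul_one]; rfl
  | add_single l i ih =>
    rw [add_right_comm, monomialProd_add_single raise_comm _ i, Module.End.mul_apply, ih,
      monomialProd_add_single raise_comm l i, Module.End.mul_apply]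

/-- The operators `raise j` are jointly locally nilpotent. -/
theorem exists_monomialProd_raise_eq_zero (x : FreeModel k N) :
    ∃ M : Fin n → ℕ, ∀ l, ¬ l ≤ M → monomialProd raise l x = 0 := by
  let S : Submodule k (FreeModel k N) :=
    { carrier := {x | ∃ M : Fin n → ℕ, ∀ l, ¬ l ≤ M → monomialProd raise l x = 0}
      zero_mem' := ⟨0, fun l _ => map_zero _⟩
      add_mem' := by
        rintro x y ⟨M, hM⟩ ⟨M', hM'⟩
        refine ⟨M ⊔ M', fun l hl => ?_⟩
        rw [map_add, hM l fun h => hl (h.trans le_sup_left),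
          hM' l fun h => hl (h.trans le_sup_right), add_zero]
      smul_mem' := by
        rintro c x ⟨M, hM⟩
        exact ⟨M, fun l hl => by rw [map_smul, hM l hl, smul_zero]⟩ }
  have hstep : ∀ x, (∀ j, raise j x ∈ S) → x ∈ S := by
    intro x hx
    choose M hM using hx
    -- The extra `1` pays for peeling off one `raise j`: the remaining exponent still exceeds `M j`
    -- in coordinate `j`.
    refine ⟨fun i => Finset.univ.sup (fun j => M j i) + 1, fun l hl => ?_⟩
    obtain ⟨j, hj⟩ : ∃ j, Finset.univ.sup (fun i => M i j) + 1 < l j := by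
      by_contra hcon
      push Not at hcon
      exact hl hcon
    have hl' : l - Pi.single j 1 + Pi.single j 1 = l := tsub_single_add_single (by omega)
    rw [← hl', monomialProd_raise_add_single]
    refine hM j _ fun hle => ?_
    have h1 : l j - 1 ≤ M j j := by simpa using hle j
    have h2 : M j j ≤ Finset.univ.sup (fun i => M i j) :=
      Finset.le_sup (f := fun i => M i j) (Finset.mem_univ j)
    omega
  have hweight : ∀ d, wordSpan k N (fun p => p.weight N < d) ≤ S := by
    intro d
    induction d with
    | zero => exact wordSpan_le fun p _ h => absurd h (Nat.not_lt_zero _)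
    | succ d ih =>
      refine wordSpan_le fun p hp hd => hstep _ fun j => ih ?_
      exact wordSpan_mono (fun q hq => lt_of_lt_of_le hq.2 (Nat.lt_succ_iff.1 hd))
        (raise_word_mem_weight j hp)
  have htop : (⊤ : Submodule k (FreeModel k N)) ≤ S := by
    rw [← span_word, Submodule.span_le]
    rintro _ ⟨p, _, rfl⟩
    exact hweight _ (word_mem_wordSpan (Nat.lt_succ_self (p.weight N)))
  exact htop trivial

theorem exists_leftMul_eq_zero (u x : FreeModel k N) :
    ∃ M : Fin n → ℕ, ∀ l, ¬ l ≤ M → leftMul u l x = 0 := by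
  induction u using induction_cons with
  | zero => exact ⟨0, fun l _ => by simp⟩
  | add u v hu hv =>
    obtain ⟨M, hM⟩ := hu
    obtain ⟨M', hM'⟩ := hv
    refine ⟨M ⊔ M', fun l hl => ?_⟩
    rw [map_add, Pi.add_apply, LinearMap.add_apply, hM l fun h => hl (h.trans le_sup_left),
      hM' l fun h => hl (h.trans le_sup_right), add_zero]
  | smul c u hu =>
    obtain ⟨M, hM⟩ := hu
    exact ⟨M, fun l hl => by
      rw [map_smul, Pi.smul_apply, LinearMap.smul_apply, hM l hl, smul_zero]⟩
  | letter i b =>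
    induction i using multiIndex_induction with
    | zero =>
      rw [leftMul_letter_zero]
      exact exists_monomialProd_raise_eq_zero (cons b 0 x)
    | add_single i j ih =>
      obtain ⟨M, hM⟩ := ih
      refine ⟨M + Pi.single j 1, fun l hl => ?_⟩
      rw [leftMul_letter_add_single, Series.nabla_apply, LinearMap.smul_apply,
        hM _ fun h => hl (tsub_le_iff_right.1 h), smul_zero]
  | cons a q u hu =>
    obtain ⟨M, hM⟩ := hu
    exact ⟨M, fun l hl => by
      rw [leftMul_cons, Series.cons_apply, Module.End.mul_apply, hM l hl, map_zero]⟩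

noncomputable instance [NeZero n] : NConformalAlgebra k n (FreeModel k N) where
  mul m := (LinearMap.proj m).comp leftMul
  D := der
  D_comm := der_comm
  locality u x := by
    obtain ⟨M, hM⟩ := exists_leftMul_eq_zero u x
    -- Every `l ≤ M` lies strictly below `M + 1`; strictness needs a coordinate, hence `n ≠ 0`.
    refine ⟨M + 1, fun l hl => hM l fun h => hl (lt_of_le_of_lt h ?_)⟩
    exact Pi.lt_def.2 ⟨le_self_add, 0, Nat.lt_succ_self _⟩
  D_mul j l u x := der_leftMul j u l x
  D_left j l u x := by
    change leftMul (der j u) l x = _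
    rw [leftMul_der]
    rfl

noncomputable instance [NeZero n] : AssocNConformalAlgebra k n (FreeModel k N) where
  assoc u v x m m' := leftMul_leftMul u v x m m'

variable (k N) in
/-- The generators of the free algebra. -/
noncomputable def gen (b : B) : FreeModel k N := word k N (letter 0 b)

theorem mul_gen [NeZero n] (m : Fin n → ℕ) (a : B) (x : FreeModel k N) :
    NConformalAlgebra.mul (k := k) m (gen k N a) x = genMul a m x := by
  change leftMul (word k N (letter 0 a)) m x = genMul a m x
  rw [leftMul_letter_zero]

theorem eval_letter_gen [NeZero n] (i : Fin n → ℕ) (b : B) :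
    eval k (gen k N) (letter i b) = word k N (letter i b) := by
  induction i using multiIndex_induction with
  | zero => rw [eval_letter_zero, gen]
  | add_single i j ih =>
    rw [eval_letter_add_single, ih]
    exact der_letter j i b

theorem respectsLocality_gen [NeZero n] : RespectsLocality k n N (gen k N) := by
  intro a b m hm
  rw [mul_gen]
  -- `raise` kills a generator, so all raises fall on the one index and the product is a single
  -- basis word or zero.
  suffices h : genMul a m (gen k N b) = cons a m (gen k N b) by
    rw [h]
    exact cons_word_of_not_lt (.letter 0 b) hm
  clear hm
  have h0 : ∀ j, raise j (gen k N b) = 0 := fun j => by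
    rw [gen, raise_letter]
    simp
  induction m using multiIndex_induction with
  | zero => rw [genMul_zero]
  | add_single m j ih =>
    rw [genMul_add_single, Module.End.mul_apply, ih, raise_cons, h0, map_zero, add_zero]

/-! ### Triangularity of right normed words against the basis words. -/

variable (k N) in
/-- The span of the normal words of length `l` and depth less than `e`. -/
noncomputable abbrev depthSpan (l e : ℕ) : Submodule k (FreeModel k N) :=
  wordSpan k N fun p => p.length = l ∧ p.depth < e

theorem depthSpan_mono {l e e' : ℕ} (h : e ≤ e') : depthSpan k N l e ≤ depthSpan k N l e' :=
  wordSpan_mono fun _ hp => ⟨hp.1, lt_of_lt_of_le hp.2 h⟩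

theorem cons_mem_depthSpan (a : B) (q : Fin n → ℕ) {l e : ℕ} {x : FreeModel k N}
    (hx : x ∈ depthSpan k N l e) :
    cons a q x ∈ depthSpan k N (l + 1) (e + (l + 1) * ∑ j, q j) := by
  refine cons_mem_wordSpan ?_ hx
  rintro p _ ⟨rfl, hp⟩
  exact ⟨rfl, Nat.add_lt_add_right hp _⟩

theorem sum_add_single (q : Fin n → ℕ) (j : Fin n) :
    ∑ i, (q + Pi.single j 1 : Fin n → ℕ) i = ∑ i, q i + 1 := by
  simp [Finset.sum_add_distrib]

/-- An index counts in the depth with the number of letters after it, at most the length of the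
word, so a single raise costs at most that much. -/
theorem raise_mem_depthSpan (j : Fin n) {l e : ℕ} {x : FreeModel k N}
    (hx : x ∈ depthSpan k N l e) : raise j x ∈ depthSpan k N l (e + l) := by
  refine apply_mem_of_mem_wordSpan (fun p hp hP => ?_) hx
  clear hx
  induction hp generalizing l e with
  | letter i b =>
    rw [raise_letter]
    refine Submodule.smul_mem _ _ (word_mem_wordSpan ⟨hP.1, ?_⟩)
    exact Nat.lt_add_right l hP.2
  | mul a m p hm hp ih =>
    obtain ⟨rfl, hd⟩ := hP
    have hd' : p.depth + (p.length + 1) * ∑ j, m j < e := hd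
    have hp' : word k N p ∈ depthSpan k N p.length (p.depth + 1) :=
      word_mem_wordSpan ⟨rfl, Nat.lt_succ_self _⟩
    rw [← cons_word a m hp, raise_cons]
    refine add_mem (depthSpan_mono ?_ (cons_mem_depthSpan a _ hp'))
      (depthSpan_mono ?_ (cons_mem_depthSpan a m (ih ⟨rfl, Nat.lt_succ_self _⟩)))
    · rw [sum_add_single, mul_add, mul_one, ConformalWord.length]
      omega
    · rw [ConformalWord.length]
      omega

/-- The term with all raises on the outermost index dominates, since that index has the largest
factor in the depth. With strict bounds, `e + 1` in the hypothesis against `e` in the conclusion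
says that the difference drops below this leading term. -/
theorem genMul_sub_cons_mem_depthSpan (a : B) (m : Fin n → ℕ) {l e : ℕ} {x : FreeModel k N}
    (hx : x ∈ depthSpan k N l (e + 1)) :
    genMul a m x - cons a m x ∈ depthSpan k N (l + 1) (e + (l + 1) * ∑ j, m j) := by
  induction m using multiIndex_induction with
  | zero => simp [genMul_zero]
  | add_single m j ih =>
    have h : genMul a (m + Pi.single j 1) x - cons a (m + Pi.single j 1) x =
        raise j (genMul a m x - cons a m x) + cons a m (raise j x) := by
      rw [genMul_add_single, Module.End.mul_apply, map_sub, raise_cons]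
      abel
    rw [h, sum_add_single, mul_add, mul_one]
    refine add_mem (depthSpan_mono ?_ (raise_mem_depthSpan j ih))
      (depthSpan_mono ?_ (cons_mem_depthSpan a m (raise_mem_depthSpan j hx)))
    · omega
    · omega

theorem eval_sub_word_mem_depthSpan [NeZero n] {p : ConformalWord n B} (hp : IsNormal N p) :
    eval k (gen k N) p - word k N p ∈ depthSpan k N p.length p.depth := by
  induction hp with
  | letter i b => simp [eval_letter_gen]
  | mul a m p hm hp ih =>
    have hp' : eval k (gen k N) p ∈ depthSpan k N p.length (p.depth + 1) := by
      rw [← sub_add_cancel (eval k (gen k N) p) (word k N p)]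
      exact add_mem (depthSpan_mono (Nat.le_succ _) ih)
        (word_mem_wordSpan ⟨rfl, Nat.lt_succ_self _⟩)
    have h : eval k (gen k N) (mul (letter 0 a) m p) - word k N (mul (letter 0 a) m p) =
        (genMul a m (eval k (gen k N) p) - cons a m (eval k (gen k N) p)) +
          cons a m (eval k (gen k N) p - word k N p) := by
      rw [eval_mul_letter_zero, mul_gen, ← cons_word a m hp, map_sub]
      abel
    rw [h]
    exact add_mem (genMul_sub_cons_mem_depthSpan a m hp') (cons_mem_depthSpan a m ih)

variable (k N) in
/-- The linear map from normal words to their values. -/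
noncomputable def evalMap [NeZero n] : Module.End k (FreeModel k N) :=
  extend fun p => eval k (gen k N) p

theorem evalMap_word [NeZero n] {p : ConformalWord n B} (hp : IsNormal N p) :
    evalMap k N (word k N p) = eval k (gen k N) p :=
  extend_word _ hp

theorem evalMap_sub_mem_depthSpan [NeZero n] {l e : ℕ} {x : FreeModel k N}
    (hx : x ∈ depthSpan k N l (e + 1)) : evalMap k N x - x ∈ depthSpan k N l e := by
  refine apply_mem_of_mem_wordSpan (f := evalMap k N - 1) (fun p hp hP => ?_) hx
  rw [LinearMap.sub_apply, evalMap_word hp, Module.End.one_apply]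
  obtain ⟨rfl, hd⟩ := hP
  exact depthSpan_mono (Nat.lt_succ_iff.1 hd) (eval_sub_word_mem_depthSpan hp)

theorem depthSpan_zero (l : ℕ) : depthSpan k N l 0 = ⊥ :=
  le_bot_iff.1 (wordSpan_le fun _ _ h => absurd h.2 (Nat.not_lt_zero _))

/-- By induction on depth: `x` differs from `evalMap k N x` by an element of smaller depth. -/
theorem evalMap_surjective [NeZero n] : Function.Surjective (evalMap k N) := by
  have h : ∀ l e, depthSpan k N l e ≤ LinearMap.range (evalMap k N) := by
    intro l e
    induction e with
    | zero => rw [depthSpan_zero]; exact bot_le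
    | succ e ih =>
      intro x hx
      rw [← sub_sub_cancel (evalMap k N x) x]
      exact sub_mem (LinearMap.mem_range_self _ x) (ih (evalMap_sub_mem_depthSpan hx))
  rw [← LinearMap.range_eq_top, eq_top_iff, ← span_word, Submodule.span_le]
  rintro _ ⟨p, _, rfl⟩
  exact h p.length (p.depth + 1) (word_mem_wordSpan ⟨rfl, Nat.lt_succ_self _⟩)

/-- `1 - evalMap k N` lowers depth and so is locally nilpotent, yet it fixes every element of the
kernel. -/
theorem evalMap_injective [NeZero n] : Function.Injective (evalMap k N) := by
  set f : Module.End k (FreeModel k N) := 1 - evalMap k N with hf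
  have hdepth : ∀ l e x, x ∈ depthSpan k N l e → (f ^ e) x = 0 := by
    intro l e
    induction e with
    | zero =>
      intro x hx
      rw [depthSpan_zero, Submodule.mem_bot] at hx
      rw [hx, map_zero]
    | succ e ih =>
      intro x hx
      rw [pow_succ, Module.End.mul_apply]
      refine ih _ ?_
      rw [hf, LinearMap.sub_apply, Module.End.one_apply, ← neg_sub]
      exact neg_mem (evalMap_sub_mem_depthSpan hx)
  have hnil : ∀ x, ∃ e, (f ^ e) x = 0 := by
    intro x
    have hx : x ∈ Submodule.span k {x | ∃ p, IsNormal N p ∧ word k N p = x} := by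
      rw [span_word]
      trivial
    induction hx using Submodule.span_induction with
    | mem x hx =>
      obtain ⟨p, _, rfl⟩ := hx
      exact ⟨p.depth + 1, hdepth p.length _ _ (word_mem_wordSpan ⟨rfl, Nat.lt_succ_self _⟩)⟩
    | zero => exact ⟨0, map_zero _⟩
    | add x y _ _ hx hy =>
      obtain ⟨e, he⟩ := hx
      obtain ⟨e', he'⟩ := hy
      refine ⟨e + e', ?_⟩
      rw [map_add, pow_add, Module.End.mul_apply, Module.End.mul_apply, he', map_zero, add_zero,
        ← Module.End.mul_apply, ← pow_add, add_comm, pow_add, Module.End.mul_apply, he, map_zero]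
    | smul c x _ hx =>
      obtain ⟨e, he⟩ := hx
      exact ⟨e, by rw [map_smul, he, smul_zero]⟩
  refine (injective_iff_map_eq_zero _).2 fun x hx => ?_
  obtain ⟨e, he⟩ := hnil x
  have hfix : ∀ e, (f ^ e) x = x := by
    intro e
    induction e with
    | zero => rfl
    | succ e ih =>
      rw [pow_succ', Module.End.mul_apply, ih, hf, LinearMap.sub_apply, hx, sub_zero,
        Module.End.one_apply]
  rw [← hfix e, he]

variable (k N) in
/-- The basis of the values of the normal words. -/
noncomputable def evalBasis [NeZero n] :
    Module.Basis {p : ConformalWord n B // IsNormal N p} k (FreeModel k N) :=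
  (basis k N).map (LinearEquiv.ofBijective (evalMap k N) ⟨evalMap_injective, evalMap_surjective⟩)

theorem evalBasis_apply [NeZero n] (p : {p : ConformalWord n B // IsNormal N p}) :
    evalBasis k N p = eval k (gen k N) p.1 := by
  rw [evalBasis, Module.Basis.map_apply, ← word_of_isNormal p.2]
  exact evalMap_word p.2

/-! ### Generation, universal property, and transfer to arbitrary free algebras. -/

theorem isGeneratedBy_gen [NeZero n] : IsGeneratedBy k n (gen k N) := by
  intro S hgen hD hmul
  rw [eq_top_iff, ← (evalBasis k N).span_eq, Submodule.span_le]
  rintro _ ⟨⟨p, hp⟩, rfl⟩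
  rw [evalBasis_apply, SetLike.mem_coe]
  induction p with
  | letter i b =>
    induction i using multiIndex_induction with
    | zero => rw [eval_letter_zero]; exact hgen b
    | add_single i j ih =>
      rw [eval_letter_add_single]
      exact hD j _ (ih (.letter i b))
  | mul p m q hp' hq' =>
    obtain _ | ⟨a, _, _, _, hq⟩ := hp
    rw [eval]
    exact hmul m _ (hp' (.letter 0 a)) _ (hq' hq)

/-- Homomorphisms which agree on a generating set are equal. -/
theorem _root_.NConformalHom.ext_of_isGeneratedBy {C : Type w} [AddCommGroup C] [Module k C]
    [NConformalAlgebra k n C] {C' : Type t} [AddCommGroup C'] [Module k C']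
    [NConformalAlgebra k n C'] {ι : B → C} (hι : IsGeneratedBy k n ι)
    {f g : NConformalHom k n C C'} (h : ∀ b, f.toLinearMap (ι b) = g.toLinearMap (ι b)) :
    f = g := by
  have htop := hι (LinearMap.eqLocus f.toLinearMap g.toLinearMap) h
    (fun i a ha => by
      have hf := f.map_D i a
      have hg := g.map_D i a
      rw [LinearMap.mem_eqLocus] at ha ⊢
      exact hf.trans ((congrArg _ ha).trans hg.symm))
    (fun m a ha b hb => by
      have hf := f.map_mul m a b
      have hg := g.map_mul m a b
      rw [LinearMap.mem_eqLocus] at ha hb ⊢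
      exact hf.trans ((congrArg₂ (fun x y => NConformalAlgebra.mul (k := k) (n := n) m x y) ha hb).trans
        hg.symm))
  have hlin : f.toLinearMap = g.toLinearMap := LinearMap.ext fun x => by
    have hx : x ∈ LinearMap.eqLocus f.toLinearMap g.toLinearMap := htop ▸ trivial
    exact hx
  cases f
  cases g
  congr

section Universal

variable [NeZero n] {C : Type w} [AddCommGroup C] [Module k C] [AssocNConformalAlgebra k n C]

/-- The linear map which sends the values of normal words to their values in `C`. -/
noncomputable def liftLinear (ε : B → C) : FreeModel k N →ₗ[k] C :=
  (evalBasis k N).constr k fun p => eval k ε p.1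

theorem eval_prodMk (ε : B → C) (p : ConformalWord n B) :
    eval k (fun b => (ε b, gen k N b)) p = (eval k ε p, eval k (gen k N) p) :=
  Prod.ext ((NConformalHom.fst k n C (FreeModel k N)).map_eval _ p)
    ((NConformalHom.snd k n C (FreeModel k N)).map_eval _ p)

theorem liftLinear_eval (ε : B → C) {p : ConformalWord n B} (hp : IsNormal N p) :
    liftLinear ε (eval k (gen k N) p) = eval k ε p := by
  have h := (evalBasis k N).constr_basis k (fun p => eval k ε p.1) ⟨p, hp⟩
  rwa [evalBasis_apply] at h

/-- The graph of `liftLinear ε` is the span of the values of the normal words in the product. -/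
theorem mem_normalSpanTop_prodMk (ε : B → C) (z : C × FreeModel k N) :
    z ∈ normalSpanTop k N (fun b => (ε b, gen k N b)) ↔ z.1 = liftLinear ε z.2 := by
  constructor
  · intro hz
    suffices h : normalSpanTop k N (fun b => (ε b, gen k N b)) ≤ LinearMap.eqLocus
      (LinearMap.fst k C (FreeModel k N))
      ((liftLinear ε).comp (LinearMap.snd k C (FreeModel k N))) from h hz
    refine Submodule.span_le.2 ?_
    rintro _ ⟨⟨p, hp⟩, rfl⟩
    change (eval k (fun b => (ε b, gen k N b)) p).1 =
      liftLinear ε (eval k (fun b => (ε b, gen k N b)) p).2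
    rw [eval_prodMk]
    exact (liftLinear_eval ε hp).symm
  · obtain ⟨y, x⟩ := z
    rintro (rfl : y = liftLinear ε x)
    suffices h : (⊤ : Submodule k (FreeModel k N)) ≤
        (normalSpanTop k N (fun b => (ε b, gen k N b))).comap
          ((liftLinear ε).prod LinearMap.id) from h (Submodule.mem_top (x := x))
    rw [← (evalBasis k N).span_eq, Submodule.span_le]
    rintro _ ⟨p, rfl⟩
    refine Submodule.subset_span ⟨p, ?_⟩
    change eval k _ p.1 = (liftLinear ε (evalBasis k N p), evalBasis k N p)
    rw [evalBasis_apply, liftLinear_eval ε p.2, eval_prodMk]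

/-- The homomorphism from the free algebra given by the images of the generators. -/
noncomputable def lift (ε : B → C) (hε : RespectsLocality k n N ε) :
    NConformalHom k n (FreeModel k N) C where
  toLinearMap := liftLinear ε
  map_mul m x y := by
    -- The graph is a span of normal words in `C × FreeModel k N`, so the spanning theorem closes it
    -- under products; this is multiplicativity of `liftLinear ε`.
    have h := mul_mem_normalSpanTop (hε.prodMk respectsLocality_gen) m
      ((mem_normalSpanTop_prodMk ε (liftLinear ε x, x)).2 rfl)
      ((mem_normalSpanTop_prodMk ε (liftLinear ε y, y)).2 rfl)
    exact ((mem_normalSpanTop_prodMk ε _).1 h).symm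
  map_D j x := by
    have h := D_mem_normalSpanTop j ((mem_normalSpanTop_prodMk ε (liftLinear ε x, x)).2 rfl)
    exact ((mem_normalSpanTop_prodMk ε _).1 h).symm

theorem lift_gen (ε : B → C) (hε : RespectsLocality k n N ε) (b : B) :
    (lift ε hε).toLinearMap (gen k N b) = ε b := by
  have h := liftLinear_eval (k := k) (N := N) ε (.letter 0 b)
  rwa [eval_letter_zero, eval_letter_zero] at h

end Universal

theorem isFree [NeZero n] :
    IsFreeAssocNConformal.{u, v, max u v, t} k n N (FreeModel k N) (gen k N) where
  generated := isGeneratedBy_gen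
  respects := respectsLocality_gen
  universal _ _ _ _ ε hε := ⟨lift ε hε, lift_gen ε hε, fun _ hg =>
    NConformalHom.ext_of_isGeneratedBy isGeneratedBy_gen fun b =>
      (hg b).trans (lift_gen ε hε b).symm⟩

end FreeModel

/-- A map to the model sends the normal words to its basis. It is obtained as the second component
of a homomorphism to `C × FreeModel k N`, since the product lies in the universe that the universal
property tests. -/
theorem IsFreeAssocNConformal.linearIndependent [NeZero n] {C : Type w} [AddCommGroup C]
    [Module k C] [AssocNConformalAlgebra k n C] {ι : B → C}
    (h : IsFreeAssocNConformal.{u, v, w, max u v w} k n N C ι) :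
    LinearIndependent k fun p : {p : ConformalWord n B // IsNormal N p} => eval k ι p.1 := by
  obtain ⟨f, hf, -⟩ := h.universal (C × FreeModel k N) (fun b => (ι b, FreeModel.gen k N b))
    (h.respects.prodMk FreeModel.respectsLocality_gen)
  refine LinearIndependent.of_comp ((LinearMap.snd k C (FreeModel k N)).comp f.toLinearMap) ?_
  convert (FreeModel.evalBasis k N).linearIndependent using 1
  funext p
  rw [FreeModel.evalBasis_apply, Function.comp_apply, LinearMap.comp_apply, f.map_eval,
    funext hf, FreeModel.eval_prodMk]
  rfl

end ModelAlgebra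

theorem mainTheorem2 {k : Type u} [Field k] [CharZero k] {n : ℕ} (hn : 0 < n)
    {B : Type v} [Nonempty B] (N : B → B → Fin n → ℕ) :
    (∃ (C : Type (max u v)) (_ : AddCommGroup C) (_ : Module k C)
        (_ : AssocNConformalAlgebra k n C) (ι : B → C),
        IsFreeAssocNConformal.{u, v, max u v, max u v w} k n N C ι) ∧
    (∀ (C : Type w) [AddCommGroup C] [Module k C] [AssocNConformalAlgebra k n C] (ι : B → C),
        IsFreeAssocNConformal.{u, v, w, max u v w} k n N C ι →
        ∃ b : Module.Basis {p : ConformalWord n B // ConformalWord.IsNormal N p} k C,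
          ∀ p, b p = ConformalWord.eval k ι p.1) := by
  have : NeZero n := ⟨hn.ne'⟩
  refine ⟨⟨FreeModel k N, inferInstance, inferInstance, inferInstance, FreeModel.gen k N,
    FreeModel.isFree⟩, fun C _ _ _ ι h => ?_⟩
  have hspan : ⊤ ≤ Submodule.span k (Set.range fun p :
      {p : ConformalWord n B // ConformalWord.IsNormal N p} => ConformalWord.eval k ι p.1) :=
    (ConformalWord.normalSpanTop_eq_top h.generated h.respects).ge
  exact ⟨Module.Basis.mk h.linearIndependent hspan, Module.Basis.mk_apply _ _⟩
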